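/- Let $d\ge 1$ and let $Z(t)$, $t\in\mathbb{R}^d$, be a non-negative random field with almost surely càdlàg paths (at every point limits exist from all octants, with continuity from the octant $\{s: s_i\ge t_i\ \forall i\}$), such that $\mathbb{E}[Z(t)]=1$ for all $t$, $\mathbb{E}[\sup_{t\in[0,T]^d}Z(t)]<\infty$ for all $T>0$ and $\mathbb{P}(\sup_{t\in\mathbb{R}^d}Z(t)>0)=1$. Assume that $Z$ is the spectral random field of a stationary max-stable random field $X$, i.e. $X(t)=\max_{i\ge 1}\Gamma_i^{-1}Z^{(i)}(t)$, $t\in\mathbb{R}^d$, is stationary, where $\Gamma_i=\mathcal V_1+\dots+\mathcal V_i$ with $\mathcal V_k$ independent unit exponential random variables that are independent of the independent copies $Z^{(i)}$ of $Z$. For $\delta>0$ let $\lambda_\delta$ be $\delta^d$ times the counting measure on $\delta\mathbb{Z}^d$; let $\lambda_0$ be the Lebesgue measure and $0\mathbb{Z}^d=\mathbb{R}^d$. For $\delta,x\ge 0$ define the Berman function $$\mathcal{B}_Z^\delta(x)=\lim_{T\to\infty}\frac1{T^d}\int_0^\infty \mathbb{P}\Bigl(\int_{[0,T]^d\cap\delta\mathbb{Z}^d}\mathbb{I}(Z(t)>s)\,\lambda_\delta(dt)>x\Bigr)ds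 .$$ Let $\Theta$ be a random field with càdlàg paths and law $\mu(A)=\mathbb{E}[Z(0)\,\mathbb{I}(Z/Z(0)\in A)]$, let $R$ be independent of $\Theta$ with $\mathbb{P}(R>r)=1/r$, $r\ge 1$, and put $Y(t)=R\,\Theta(t)$ and $\epsilon_\delta(Y)=\int_{\delta\mathbb{Z}^d}\mathbb{I}(Y(t)>1)\,\lambda_\delta(dt)\in[0,\infty]$. Let $S_0=\int_{\mathbb{R}^d}Z(t)\,dt$ and suppose that $\mathbb{P}(S_0=\infty)<1$. Then: (i) If $Z$ has almost surely continuous trajectories, then the distribution of $\epsilon_0(Y)$ is continuous on $[0,\infty)$, i.e. $\mathbb{P}(\epsilon_0(Y)=x)=0$ for every $x\in[0,\infty)$. (ii) For all $\delta,x\ge 0$ with $\mathbb{P}(x<\epsilon_\delta(Y)<\infty)>0$, the limit defining $\mathcal{B}_Z^\delta(x)$ exists and $0<\mathcal{B}_Z^\delta(x)<\infty$. (iii) If $\mathbb{P}(S_0<\infty)=1$, then $\mathbb{P}(\epsilon_\delta(Y)<\infty)=1$ for every $\delta\ge 0$. Hence in this case the distribution of $\epsilon_0(Y)$ in (i) is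 a continuous distribution on $[0,\infty)$, and the condition in (ii) is $\mathbb{P}(\epsilon_\delta(Y)>x)>0$. -/

import Mathlib

open MeasureTheory ProbabilityTheory Filter Topology
open scoped ENNReal

noncomputable section

namespace Berman

/-- The octant at `t` with sign pattern `σ`: the points `s` with `t i ≤ s i` where `σ i` is true
and `s i < t i` where `σ i` is false. -/
def octant {d : ℕ} (t : Fin d → ℝ) (σ : Fin d → Bool) : Set (Fin d → ℝ) :=
  {s | ∀ i, (σ i = true → t i ≤ s i) ∧ (σ i = false → s i < t i)}

/-- The space `D` of non-negative (generalised) càdlàg functions on `ℝ^d`: limits exist (in `ℝ`)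
from every octant, and the function is continuous from the upper right octant. -/
def cadlagSpace (d : ℕ) : Set ((Fin d → ℝ) → ℝ) :=
  {f | (∀ t, 0 ≤ f t) ∧
    ∀ t, ContinuousWithinAt f (Set.Ici t) t ∧
      ∀ σ : Fin d → Bool, ∃ l : ℝ, Tendsto f (𝓝[octant t σ] t) (𝓝 l)}

/-- The set `δ ℤ^d`, with the convention `0 ℤ^d = ℝ^d`. -/
def grid (d : ℕ) (δ : ℝ) : Set (Fin d → ℝ) :=
  {t | δ = 0 ∨ ∃ k : Fin d → ℤ, t = fun i => δ * (k i : ℝ)}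

open Classical in
/-- The measure `λ_δ`: Lebesgue measure on `ℝ^d` if `δ = 0`, and `δ^d` times the counting measure
on `δ ℤ^d` if `δ > 0`. -/
def gridMeasure (d : ℕ) (δ : ℝ) : Measure (Fin d → ℝ) :=
  if δ = 0 then volume
  else ENNReal.ofReal (δ ^ d) •
    Measure.sum fun k : Fin d → ℤ => Measure.dirac fun i => δ * (k i : ℝ)

/-- The sojourn `∫_{A ∩ δ ℤ^d} 𝟙(f(t) > s) λ_δ(dt)`. -/
def sojourn {d : ℕ} (δ : ℝ) (A : Set (Fin d → ℝ)) (f : (Fin d → ℝ) → ℝ) (s : ℝ) : ℝ≥0∞ :=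
  gridMeasure d δ {t | t ∈ A ∩ grid d δ ∧ s < f t}

/-- `ε_δ(f) = ∫_{δ ℤ^d} 𝟙(f(t) > 1) λ_δ(dt)`. -/
def epsilon {d : ℕ} (δ : ℝ) (f : (Fin d → ℝ) → ℝ) : ℝ≥0∞ :=
  sojourn δ Set.univ f 1

/-- `S_0(f) = ∫_{ℝ^d} f(t) dt` for non-negative `f`. -/
def totalMass {d : ℕ} (f : (Fin d → ℝ) → ℝ) : ℝ≥0∞ :=
  ∫⁻ t, ENNReal.ofReal (f t)

/-- The cube `[0,T]^d`. -/
def cube (d : ℕ) (T : ℝ) : Set (Fin d → ℝ) :=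
  Set.Icc (fun _ => 0) (fun _ => T)

section Fields

variable {d : ℕ} {Ω : Type*} [MeasurableSpace Ω]

/-- `B_Z^δ([0,T]^d ∩ δ ℤ^d, x)`. -/
def bermanOn (P : Measure Ω) (Z : (Fin d → ℝ) → Ω → ℝ) (δ x T : ℝ) : ℝ≥0∞ :=
  ∫⁻ s in Set.Ioi (0 : ℝ),
    P {ω | ENNReal.ofReal x < sojourn δ (cube d T) (fun t => Z t ω) s}

/-- `T^{-d} B_Z^δ([0,T]^d ∩ δ ℤ^d, x)`. -/
def bermanRatio (P : Measure Ω) (Z : (Fin d → ℝ) → Ω → ℝ) (δ x T : ℝ) : ℝ≥0∞ :=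
  bermanOn P Z δ x T / ENNReal.ofReal (T ^ d)

/-- The Berman function `B_Z^δ(x) = lim_{T → ∞} T^{-d} B_Z^δ([0,T]^d ∩ δ ℤ^d, x)`; meaningful
when the limit exists. -/
def bermanFunction (P : Measure Ω) (Z : (Fin d → ℝ) → Ω → ℝ) (δ x : ℝ) : ℝ≥0∞ :=
  limUnder atTop (bermanRatio P Z δ x)

/-- The standing assumptions on the non-negative random field `Z` itself. -/
structure IsSpectralField (P : Measure Ω) (Z : (Fin d → ℝ) → Ω → ℝ) : Prop where
  measurable : ∀ t, Measurable (Z t)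
  paths : ∀ᵐ ω ∂P, (fun t => Z t ω) ∈ cadlagSpace d
  mean_one : ∀ t, ∫ ω, Z t ω ∂P = 1
  sup_integrable : ∀ T : ℝ, 0 < T →
    ∫⁻ ω, ⨆ t ∈ cube d T, ENNReal.ofReal (Z t ω) ∂P < ∞
  sup_pos : ∀ᵐ ω ∂P, ∃ t, 0 < Z t ω

/-- `V` are independent unit exponential variables, independent of the independent copies `Zs i`
of the random field `Z`. -/
structure IsDeHaanFamily (P : Measure Ω) (Z : (Fin d → ℝ) → Ω → ℝ)
    {Ω' : Type*} [MeasurableSpace Ω'] (P' : Measure Ω')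
    (V : ℕ → Ω' → ℝ) (Zs : ℕ → (Fin d → ℝ) → Ω' → ℝ) : Prop where
  measurable_exp : ∀ k, Measurable (V k)
  law_exp : ∀ k, P'.map (V k) = expMeasure 1
  indep_exp : iIndepFun V P'
  measurable_copy : ∀ i t, Measurable (Zs i t)
  law_copy : ∀ i, P'.map (fun ω t => Zs i t ω) = P.map (fun ω t => Z t ω)
  indep_copy : iIndepFun (fun i ω t => Zs i t ω) P'
  indep : IndepFun (fun ω k => V k ω) (fun ω i t => Zs i t ω) P'

/-- The max-stable field `X(t) = max_i Γ_i⁻¹ Z^{(i)}(t)`, with `Γ_i` the partial sums of `V`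
(indices start at `0` here, so that `Γ_i = V_0 + ... + V_i`). -/
def maxStableField {Ω' : Type*} (V : ℕ → Ω' → ℝ) (Zs : ℕ → (Fin d → ℝ) → Ω' → ℝ)
    (t : Fin d → ℝ) (ω : Ω') : ℝ≥0∞ :=
  ⨆ i : ℕ, ENNReal.ofReal ((∑ k ∈ Finset.range (i + 1), V k ω)⁻¹ * Zs i t ω)

/-- (Strict) stationarity of a random field: all shifts have the same finite-dimensional
distributions, that is, the same law on the product space. -/
def IsStationary (P : Measure Ω) (X : (Fin d → ℝ) → Ω → ℝ≥0∞) : Prop :=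
  ∀ h : Fin d → ℝ, IdentDistrib (fun ω t => X (t + h) ω) (fun ω t => X t ω) P P

/-- `Θ` is a random field with càdlàg paths and law
`μ(A) = E[Z(0) 𝟙(Z / Z(0) ∈ A)]`. -/
structure IsTilted (P : Measure Ω) (Z : (Fin d → ℝ) → Ω → ℝ)
    {Ω' : Type*} [MeasurableSpace Ω'] (Q : Measure Ω') (Θ : (Fin d → ℝ) → Ω' → ℝ) : Prop where
  measurable : ∀ t, Measurable (Θ t)
  paths : ∀ᵐ ω ∂Q, (fun t => Θ t ω) ∈ cadlagSpace d
  law : Q.map (fun ω t => Θ t ω) =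
    (P.withDensity fun ω => ENNReal.ofReal (Z 0 ω)).map (fun ω t => Z t ω / Z 0 ω)

end Fields

end Berman

end

/-! Everything is read off one measure `ν = spectralMeasure P X`, the image of `P(dω) ds` on `s > 0`
under `Z / s`, where `X` is a path-valued modification of `Z`. Sojourns of `Z` above `s` are
sojourns of `Z / s` above `1`, so the numerator of the Berman ratio is the `ν`-mass of paths whose
sojourn above `1` in `[0,T]^d` exceeds `x`. The substitution `r = Z(0) / s` turns Lebesgue measure
on `(0, Z(0))` into `Z(0)` times the Pareto law. Hence `Y = R Θ` has law `ν` restricted to `{f(0) >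
1}` (`map_eq_restrict_spectralMeasure`).

Stationarity of the max-stable field makes `ν` shift invariant (`map_shift_spectralMeasure`). Indeed
`E max Z(t + h) / y` over finitely many pairs `(t, y)` is the limit, as `u → ∞`, of `u` times the
probability that the field exceeds `u y` at some `t + h`. It therefore does not depend on `h`. These
expectations are the `ν`-masses of exceedance sets, which determine `ν` on non-zero paths.

Invariance gives (ii). If a path has sojourn `l > x` in the cube, then `1` is the integral of `1 /
l` over its exceedance points. Moving each point to the origin (`measure_lt_sojournIn`) writes the
numerator as an integral over the cube of `E[1(l > x) / l]`, with `l` the sojourn of `Y` in the cube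
seen from that point. Most points see a huge window, so the ratio tends to `E[1(ε > x) / ε]`, which
is positive under the hypothesis. The upper bound needs `1(l > x) / l` bounded, which fails only for
`x = δ = 0`. There subadditivity gives a finite limit and the lower bound keeps it positive.

For (i), a continuous path admits at most one level below `Z(0)` whose superlevel set has a given
finite volume, and a single `s` is Lebesgue null. For (iii) with `δ = 0`, Markov's inequality
applies. For `δ > 0`, a mass transport between lattice exceedances and cells carries finiteness of
the volume over to the lattice (`ae_tsum_lattice_lt_top`). -/

noncomputable section

namespace Berman

/-! ### Càdlàg path space: shifts, scalings, joint measurability -/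

section Paths

variable {d : ℕ}

/-- The path space `D` with the σ-algebra generated by the evaluations. -/
abbrev Path (d : ℕ) : Type := cadlagSpace d

lemma measurable_eval (t : Fin d → ℝ) : Measurable fun f : Path d => f.1 t :=
  (measurable_pi_apply t).comp measurable_subtype_coe

lemma tendsto_add_octant (t h : Fin d → ℝ) (σ : Fin d → Bool) :
    Tendsto (fun s => s + h) (𝓝[octant t σ] t) (𝓝[octant (t + h) σ] (t + h)) := by
  refine tendsto_nhdsWithin_iff.2 ⟨?_, ?_⟩
  · exact ((continuous_id.add continuous_const).tendsto t).mono_left nhdsWithin_le_nhds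
  · filter_upwards [self_mem_nhdsWithin] with s hs i
    simpa using hs i

lemma shift_mem_cadlagSpace {f : (Fin d → ℝ) → ℝ} (hf : f ∈ cadlagSpace d) (h : Fin d → ℝ) :
    (fun t => f (t + h)) ∈ cadlagSpace d := by
  refine ⟨fun t => hf.1 _, fun t => ⟨?_, fun σ => ?_⟩⟩
  · refine ContinuousWithinAt.comp (t := Set.Ici (t + h)) (hf.2 (t + h)).1
      (continuous_id.add continuous_const).continuousWithinAt fun s hs => ?_
    exact add_le_add_left (Set.mem_Ici.1 hs) h
  · obtain ⟨l, hl⟩ := (hf.2 (t + h)).2 σ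
    exact ⟨l, hl.comp (tendsto_add_octant t h σ)⟩

lemma mul_mem_cadlagSpace {f : (Fin d → ℝ) → ℝ} (hf : f ∈ cadlagSpace d) {c : ℝ} (hc : 0 ≤ c) :
    (fun t => c * f t) ∈ cadlagSpace d := by
  refine ⟨fun t => mul_nonneg hc (hf.1 t), fun t => ⟨?_, fun σ => ?_⟩⟩
  · exact continuousWithinAt_const.mul (hf.2 t).1
  · obtain ⟨l, hl⟩ := (hf.2 t).2 σ
    exact ⟨c * l, hl.const_mul c⟩

lemma zero_mem_cadlagSpace : (fun _ => 0) ∈ cadlagSpace d :=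
  ⟨fun _ => le_rfl, fun _ => ⟨continuousWithinAt_const, fun _ => ⟨0, tendsto_const_nhds⟩⟩⟩

/-- The shift `f ↦ f(· + h)` on path space. -/
def shift (h : Fin d → ℝ) (f : Path d) : Path d :=
  ⟨fun t => f.1 (t + h), shift_mem_cadlagSpace f.2 h⟩

/-- The path `|c| f`. -/
def scale (c : ℝ) (f : Path d) : Path d :=
  ⟨fun t => |c| * f.1 t, mul_mem_cadlagSpace f.2 (abs_nonneg c)⟩

lemma measurable_path_iff {α : Type*} [MeasurableSpace α] {g : α → Path d} :
    Measurable g ↔ ∀ t, Measurable fun a => (g a).1 t := by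
  refine ⟨fun h t => (measurable_eval t).comp h, fun h => ?_⟩
  exact Measurable.subtype_mk (f := fun a => (g a).1) (measurable_pi_iff.2 h) (h := fun a => (g a).2)

lemma measurable_shift (h : Fin d → ℝ) : Measurable (shift h : Path d → Path d) :=
  measurable_path_iff.2 fun t => measurable_eval (t + h)

lemma measurable_scale : Measurable fun p : ℝ × Path d => scale p.1 p.2 :=
  measurable_path_iff.2 fun t =>
    (continuous_abs.measurable.comp measurable_fst).mul ((measurable_eval t).comp measurable_snd)

/-- Continuity from the upper right octant makes evaluation at `t` the limit of evaluations at
lattice points of mesh `1 / (n + 1)` chosen strictly to the upper right of `t`. Each approximation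
takes only countably many points as arguments. -/
lemma measurable_eval_uncurry : Measurable fun p : Path d × (Fin d → ℝ) => p.1.1 p.2 := by
  let r (n : ℕ) (k : Fin d → ℤ) : Fin d → ℝ := fun i => ((k i : ℝ) + 1) / (n + 1)
  let q (n : ℕ) (t : Fin d → ℝ) : Fin d → ℤ := fun i => ⌊((n : ℝ) + 1) * t i⌋
  have hlim : ∀ t : Fin d → ℝ, Tendsto (fun n => r n (q n t)) atTop (𝓝[Set.Ici t] t) := by
    intro t
    have hlow : ∀ n i, t i ≤ r n (q n t) i := by
      intro n i
      have hn : (0 : ℝ) < n + 1 := by positivity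
      simp only [r, q]
      rw [le_div_iff₀ hn]
      linarith [Int.lt_floor_add_one (((n : ℝ) + 1) * t i)]
    have hup : ∀ n i, r n (q n t) i ≤ t i + 1 / ((n : ℝ) + 1) := by
      intro n i
      have hn : (0 : ℝ) < n + 1 := by positivity
      simp only [r, q]
      have h1 : (t i + 1 / ((n : ℝ) + 1)) * (n + 1) = (n + 1) * t i + 1 := by field_simp
      rw [div_le_iff₀ hn, h1]
      linarith [Int.floor_le (((n : ℝ) + 1) * t i)]
    refine tendsto_nhdsWithin_iff.2 ⟨tendsto_pi_nhds.2 fun i => ?_, .of_forall fun n i => hlow n i⟩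
    refine tendsto_of_tendsto_of_tendsto_of_le_of_le tendsto_const_nhds ?_
      (fun n => hlow n i) (fun n => hup n i)
    simpa using tendsto_const_nhds.add (tendsto_one_div_add_atTop_nhds_zero_nat (𝕜 := ℝ))
  refine measurable_of_tendsto_metrizable
    (f := fun n (p : Path d × (Fin d → ℝ)) => p.1.1 (r n (q n p.2))) (fun n => ?_) ?_
  · have h1 : Measurable fun p : Path d × (Fin d → ℤ) => p.1.1 (r n p.2) :=
      measurable_from_prod_countable_left fun k => measurable_eval (r n k)
    have h2 : Measurable (q n) := measurable_pi_iff.2 fun i =>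
      Int.measurable_floor.comp ((measurable_pi_apply i).const_mul _)
    exact h1.comp (measurable_fst.prodMk (h2.comp measurable_snd))
  · refine tendsto_pi_nhds.2 fun p => ?_
    exact Tendsto.comp (p.1.2.2 p.2).1 (hlim p.2)

lemma measurableSet_superlevel (f : Path d) (s : ℝ) : MeasurableSet {t | s < f.1 t} :=
  measurableSet_lt measurable_const
    (measurable_eval_uncurry.comp (measurable_const.prodMk measurable_id))

lemma exists_path_modification {Ω : Type*} [MeasurableSpace Ω] {P : Measure Ω}
    {X : (Fin d → ℝ) → Ω → ℝ} (hX : ∀ t, Measurable (X t))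
    (hc : ∀ᵐ ω ∂P, (fun t => X t ω) ∈ cadlagSpace d) :
    ∃ X' : Ω → Path d, Measurable X' ∧ ∀ᵐ ω ∂P, (X' ω).1 = fun t => X t ω := by
  classical
  obtain ⟨N, hN, hNm, hN0⟩ := exists_measurable_superset_of_null (ae_iff.1 hc)
  have hgood : ∀ ω, ω ∉ N → (fun t => X t ω) ∈ cadlagSpace d := fun ω h => by
    by_contra h'
    exact h (hN h')
  refine ⟨fun ω => if h : ω ∈ N then ⟨_, zero_mem_cadlagSpace⟩ else ⟨_, hgood ω h⟩,
    measurable_path_iff.2 fun t => ?_, ?_⟩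
  · have : (fun ω => if ω ∈ N then 0 else X t ω) = fun ω => ((if h : ω ∈ N then
        ⟨_, zero_mem_cadlagSpace⟩ else ⟨_, hgood ω h⟩ : Path d)).1 t := by
      funext ω
      by_cases h : ω ∈ N <;> simp [h]
    rw [← this]
    exact Measurable.ite hNm measurable_const (hX t)
  · filter_upwards [compl_mem_ae_iff.2 hN0] with ω hω
    have : ω ∉ N := hω
    simp [this]

/-- A path exceeding the level `s` at `t` exceeds it on a cube with lower corner `t`. -/
lemma exists_box_superlevel (f : Path d) {s : ℝ} {t : Fin d → ℝ} (h : s < f.1 t) :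
    ∃ ε > 0, ∀ u, (∀ i, t i ≤ u i ∧ u i < t i + ε) → s < f.1 u := by
  have h1 := (f.2.2 t).1.eventually (lt_mem_nhds h)
  obtain ⟨ε, hε, hb⟩ := Metric.mem_nhdsWithin_iff.1 h1
  refine ⟨ε, hε, fun u hu => hb ⟨?_, fun i => (hu i).1⟩⟩
  rw [Metric.mem_ball, dist_pi_lt_iff hε]
  intro i
  rw [Real.dist_eq, abs_of_nonneg (by linarith [(hu i).1])]
  linarith [(hu i).2]

lemma exists_rat_superlevel (f : Path d) {s : ℝ} {t : Fin d → ℝ} (h : s < f.1 t) :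
    ∃ q : Fin d → ℚ, s < f.1 fun i => (q i : ℝ) := by
  obtain ⟨ε, hε, hb⟩ := exists_box_superlevel f h
  choose q hq using fun i => exists_rat_btwn (show t i < t i + ε by linarith)
  exact ⟨q, hb _ fun i => ⟨(hq i).1.le, (hq i).2⟩⟩

end Paths

/-! ### Exceedance probabilities of the max-stable field -/

section MaxStable

variable {d : ℕ}

lemma lintegral_expMeasure {g : ℝ → ℝ≥0∞} (hg : Measurable g) :
    ∫⁻ v, g v ∂(expMeasure 1) = ∫⁻ v in Set.Ici 0, ENNReal.ofReal (Real.exp (-v)) * g v := by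
  have h1 : Measurable (exponentialPDF 1) := (measurable_exponentialPDFReal 1).ennreal_ofReal
  have h2 : expMeasure 1 = volume.withDensity (exponentialPDF 1) := rfl
  rw [h2, lintegral_withDensity_eq_lintegral_mul _ h1 hg, ← lintegral_indicator measurableSet_Ici]
  refine lintegral_congr fun v => ?_
  simp only [Pi.mul_apply, exponentialPDF_eq, Set.indicator_apply, Set.mem_Ici]
  by_cases hv : 0 ≤ v <;> simp [hv]

/-- `P(V < a) + E (a - V)⁺ = a⁺` for a unit exponential variable `V`. -/
lemma lintegral_exp_renewal (a : ℝ) :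
    ∫⁻ v, ((Set.Iio a).indicator 1 v + ENNReal.ofReal (a - v)) ∂(expMeasure 1)
      = ENNReal.ofReal a := by
  have hm : Measurable fun v : ℝ => (Set.Iio a).indicator 1 v + ENNReal.ofReal (a - v) :=
    (measurable_one.indicator measurableSet_Iio).add (measurable_const.sub measurable_id).ennreal_ofReal
  rw [lintegral_expMeasure hm]
  have h1 : ∀ v ∈ Set.Ici (0 : ℝ), ENNReal.ofReal (Real.exp (-v)) *
      ((Set.Iio a).indicator 1 v + ENNReal.ofReal (a - v)) =
      (Set.Ico 0 a).indicator (fun v => ENNReal.ofReal (Real.exp (-v) * (1 + (a - v)))) v := by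
    intro v hv
    by_cases hva : v < a
    · have : v ∈ Set.Ico 0 a := ⟨hv, hva⟩
      rw [Set.indicator_of_mem this, Set.indicator_of_mem (Set.mem_Iio.2 hva), Pi.one_apply,
        ← ENNReal.ofReal_one, ← ENNReal.ofReal_add zero_le_one (by linarith),
        ← ENNReal.ofReal_mul (Real.exp_pos _).le]
    · have h2 : v ∉ Set.Ico 0 a := fun h => hva h.2
      have h3 : v ∉ Set.Iio a := hva
      rw [Set.indicator_of_notMem h2, Set.indicator_of_notMem h3, ENNReal.ofReal_of_nonpos (show a - v ≤ 0 by linarith)]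
      simp
  rw [setLIntegral_congr_fun measurableSet_Ici h1, setLIntegral_indicator measurableSet_Ico,
    Set.inter_eq_left.2 Set.Ico_subset_Ici_self]
  rcases le_or_gt a 0 with ha | ha
  · rw [Set.Ico_eq_empty (by simpa using ha), ENNReal.ofReal_of_nonpos ha]
    simp
  have hcont : Continuous fun v : ℝ => Real.exp (-v) * (1 + (a - v)) := by fun_prop
  -- The integrand `exp(-v) (1 + a - v)` has antiderivative `(v - a) exp(-v)`, which is `0` at `a`
  -- and `-a` at `0`.
  rw [← ofReal_integral_eq_lintegral_ofReal, integral_Ico_eq_integral_Ioo,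
    ← integral_Ioc_eq_integral_Ioo, ← intervalIntegral.integral_of_le ha.le,
    intervalIntegral.integral_eq_sub_of_hasDerivAt (f := fun v => (v - a) * Real.exp (-v))]
  · simp
  · intro v _
    have h : HasDerivAt (fun v => (v - a) * Real.exp (-v))
        (1 * Real.exp (-v) + (v - a) * (Real.exp (-v) * -1)) v :=
      ((hasDerivAt_id v).sub_const a).mul ((hasDerivAt_id v).neg.exp)
    exact h.congr_deriv (by ring)
  · exact hcont.intervalIntegrable _ _
  · exact (hcont.integrableOn_Icc).mono_set Set.Ico_subset_Icc_self
  · refine (ae_restrict_iff' measurableSet_Ico).2 (.of_forall fun v hv => ?_)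
    have := hv.2
    exact mul_nonneg (Real.exp_pos _).le (by linarith)

section Renewal

variable {Ω' : Type*} [MeasurableSpace Ω'] {P' : Measure Ω'} {V : ℕ → Ω' → ℝ}

/-- The remainder `E (w - S_n)⁺` is what makes the induction close: given `S_n`, the renewal
identity with `a = w - S_n` splits it into the next probability and the next remainder. -/
lemma sum_renewal_add_le [IsProbabilityMeasure P'] (hm : ∀ k, Measurable (V k))
    (hl : ∀ k, P'.map (V k) = expMeasure 1) (hi : iIndepFun V P') (w : ℝ) (n : ℕ) :
    ∑ i ∈ Finset.range n, P' {ω | ∑ k ∈ Finset.range (i + 1), V k ω < w} +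
      ∫⁻ ω, ENNReal.ofReal (w - ∑ k ∈ Finset.range n, V k ω) ∂P' ≤ ENNReal.ofReal w := by
  have hS : ∀ n, Measurable fun ω => ∑ k ∈ Finset.range n, V k ω := fun n =>
    Finset.measurable_sum _ fun k _ => hm k
  have := isProbabilityMeasure_expMeasure (r := 1) one_pos
  induction n with
  | zero => simp
  | succ n ih =>
    refine le_trans ?_ ih
    rw [Finset.sum_range_succ, add_assoc]
    gcongr
    have hind : IndepFun (fun ω => ∑ k ∈ Finset.range n, V k ω) (V n) P' := by
      have := hi.indepFun_finsetSum_of_notMem hm (s := Finset.range n) (i := n) (by simp)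
      convert this using 1
      ext ω
      simp
    have hmap := (indepFun_iff_map_prod_eq_prod_map_map (hS n).aemeasurable (hm n).aemeasurable).1 hind
    rw [hl n] at hmap
    let g : ℝ × ℝ → ℝ≥0∞ := fun p =>
      (Set.Iio (w - p.1)).indicator 1 p.2 + ENNReal.ofReal (w - p.1 - p.2)
    have hg : Measurable g := by
      refine Measurable.add ?_ (by fun_prop)
      have : (fun p : ℝ × ℝ => (Set.Iio (w - p.1)).indicator (1 : ℝ → ℝ≥0∞) p.2) =
          {p : ℝ × ℝ | p.2 < w - p.1}.indicator 1 := by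
        ext p
        simp [Set.indicator_apply]
      rw [this]
      exact measurable_one.indicator
        (measurableSet_lt measurable_snd (measurable_const.sub measurable_fst))
    have hms : MeasurableSet {ω | ∑ k ∈ Finset.range (n + 1), V k ω < w} :=
      measurableSet_lt (hS _) measurable_const
    calc _ = ∫⁻ ω, g (∑ k ∈ Finset.range n, V k ω, V n ω) ∂P' := by
          rw [← lintegral_indicator_one hms, ← lintegral_add_left (measurable_one.indicator hms)]
          refine lintegral_congr fun ω => ?_
          simp only [g, Finset.sum_range_succ, Set.indicator_apply, Set.mem_ofPred_eq, Set.mem_Iio,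
            lt_sub_iff_add_lt', sub_sub, Pi.one_apply]
      _ = ∫⁻ p, g p ∂((P'.map fun ω => ∑ k ∈ Finset.range n, V k ω).prod (expMeasure 1)) := by
          rw [← hmap, lintegral_map hg ((hS n).prodMk (hm n))]
      _ = ∫⁻ s, ENNReal.ofReal (w - s) ∂(P'.map fun ω => ∑ k ∈ Finset.range n, V k ω) := by
          rw [lintegral_prod _ hg.aemeasurable]
          exact lintegral_congr fun s => lintegral_exp_renewal (w - s)
      _ ≤ _ := by
          rw [lintegral_map (by fun_prop) (hS n)]

/-- The renewal measure of a unit rate Poisson process is dominated by Lebesgue measure. -/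
lemma tsum_renewal_le [IsProbabilityMeasure P'] (hm : ∀ k, Measurable (V k))
    (hl : ∀ k, P'.map (V k) = expMeasure 1) (hi : iIndepFun V P') (w : ℝ) :
    ∑' i, P' {ω | ∑ k ∈ Finset.range (i + 1), V k ω < w} ≤ ENNReal.ofReal w := by
  rw [ENNReal.tsum_eq_iSup_nat]
  exact iSup_le fun n => le_self_add.trans (sum_renewal_add_le hm hl hi w n)

/-- This is `1 - exp(-a) ≥ a / (1 + a)`, equivalent to `exp a ≥ 1 + a`. The rational form suffices
because only the behaviour as `a → 0` matters. -/
lemma le_expMeasure_Iio {a : ℝ} (ha : 0 ≤ a) :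
    ENNReal.ofReal (a / (1 + a)) ≤ expMeasure 1 (Set.Iio a) := by
  have h1 : expMeasure 1 (Set.Iio a) = ENNReal.ofReal (1 - Real.exp (-(1 * a))) := by
    have h2 : expMeasure 1 = volume.withDensity (exponentialPDF 1) := rfl
    rw [h2, withDensity_apply _ measurableSet_Iio, setLIntegral_congr Iio_ae_eq_Iic,
      lintegral_exponentialPDF_eq_antiDeriv one_pos, if_pos ha]
  rw [h1]
  refine ENNReal.ofReal_le_ofReal ?_
  have h3 : Real.exp (-(1 * a)) ≤ 1 / (1 + a) := by
    rw [one_mul, Real.exp_neg, ← one_div]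
    exact one_div_le_one_div_of_le (by linarith) (by linarith [Real.add_one_le_exp a])
  have h4 : a / (1 + a) = 1 - 1 / (1 + a) := by field_simp; ring
  linarith

end Renewal

/-- The largest ratio `f (t + h) / y` over the pairs `(t, y)` in `F`. -/
def maxRatio (F : Finset ((Fin d → ℝ) × ℝ)) (h : Fin d → ℝ) (f : (Fin d → ℝ) → ℝ) : ℝ≥0∞ :=
  ⨆ p ∈ F, ENNReal.ofReal (f (p.1 + h) / p.2)

lemma measurable_maxRatio (F : Finset ((Fin d → ℝ) × ℝ)) (h : Fin d → ℝ) :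
    Measurable (maxRatio F h) :=
  Measurable.biSup _ F.countable_toSet fun p _ =>
    ((measurable_pi_apply (p.1 + h)).div_const _).ennreal_ofReal

lemma maxRatio_lt_top (F : Finset ((Fin d → ℝ) × ℝ)) (h : Fin d → ℝ) (f : (Fin d → ℝ) → ℝ) :
    maxRatio F h f < ∞ := by
  rw [maxRatio, ← Finset.sup_eq_iSup, Finset.sup_lt_iff (by simp)]
  exact fun p _ => ENNReal.ofReal_lt_top

lemma lt_maxRatio_iff {F : Finset ((Fin d → ℝ) × ℝ)} {h : Fin d → ℝ} {f : (Fin d → ℝ) → ℝ}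
    (hF : ∀ p ∈ F, 0 < p.2) {s : ℝ} (hs : 0 ≤ s) :
    ENNReal.ofReal s < maxRatio F h f ↔ ∃ p ∈ F, s * p.2 < f (p.1 + h) := by
  simp only [maxRatio, lt_iSup_iff, exists_prop]
  refine exists_congr fun p => and_congr_right fun hp => ?_
  rw [ENNReal.ofReal_lt_ofReal_iff', lt_div_iff₀ (hF p hp)]
  refine and_iff_left_of_imp fun h1 => ?_
  exact div_pos ((mul_nonneg hs (hF p hp).le).trans_lt h1) (hF p hp)

section Stationary

variable {Ω Ω' : Type*} [MeasurableSpace Ω] [MeasurableSpace Ω'] {P : Measure Ω}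
  {P' : Measure Ω'} {Z : (Fin d → ℝ) → Ω → ℝ} {V : ℕ → Ω' → ℝ} {Zs : ℕ → (Fin d → ℝ) → Ω' → ℝ}

/-- The event that the max-stable field exceeds `x y` at `t + h` for some `(t, y)` in `F`. -/
def exceedance (V : ℕ → Ω' → ℝ) (Zs : ℕ → (Fin d → ℝ) → Ω' → ℝ)
    (F : Finset ((Fin d → ℝ) × ℝ)) (x : ℝ) (h : Fin d → ℝ) : Set Ω' :=
  {ω | ∃ p ∈ F, ENNReal.ofReal (x * p.2) < maxStableField V Zs (p.1 + h) ω}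

lemma IsStationary.measure_exceedance (hX : IsStationary P' (maxStableField V Zs))
    (F : Finset ((Fin d → ℝ) × ℝ)) (x : ℝ) (h : Fin d → ℝ) :
    P' (exceedance V Zs F x h) = P' (exceedance V Zs F x 0) := by
  have hm : MeasurableSet {g : (Fin d → ℝ) → ℝ≥0∞ | ∃ p ∈ F, ENNReal.ofReal (x * p.2) < g p.1} := by
    have : {g : (Fin d → ℝ) → ℝ≥0∞ | ∃ p ∈ F, ENNReal.ofReal (x * p.2) < g p.1} =
        ⋃ p ∈ F, {g | ENNReal.ofReal (x * p.2) < g p.1} := by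
      ext g
      simp
    rw [this]
    exact F.measurableSet_biUnion fun p _ =>
      measurableSet_lt measurable_const (measurable_pi_apply _)
  have := (hX h).measure_mem_eq hm
  simpa [exceedance] using this

lemma IsDeHaanFamily.ae_exp_pos (hV : IsDeHaanFamily P Z P' V Zs) : ∀ᵐ ω ∂P', ∀ k, 0 < V k ω := by
  refine ae_all_iff.2 fun k => ?_
  have h1 : ∀ᵐ v ∂(expMeasure 1), 0 < v := by
    rw [ae_iff]
    have h2 : expMeasure 1 = volume.withDensity (exponentialPDF 1) := rfl
    have h3 : {v : ℝ | ¬ 0 < v} = Set.Iic 0 := by ext; simp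
    rw [h3, h2, withDensity_apply _ measurableSet_Iic, setLIntegral_congr Iio_ae_eq_Iic.symm,
      lintegral_exponentialPDF_of_nonpos le_rfl]
  rw [← hV.law_exp k] at h1
  exact ae_of_ae_map (hV.measurable_exp k).aemeasurable h1

lemma IsDeHaanFamily.exceedance_ae_eq (hV : IsDeHaanFamily P Z P' V Zs)
    {F : Finset ((Fin d → ℝ) × ℝ)} (hF : ∀ p ∈ F, 0 < p.2) {x : ℝ} (hx : 0 < x) (h : Fin d → ℝ) :
    exceedance V Zs F x h =ᵐ[P'] ⋃ i, {ω | ENNReal.ofReal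
      (x * ∑ k ∈ Finset.range (i + 1), V k ω) < maxRatio F h fun t => Zs i t ω} := by
  filter_upwards [hV.ae_exp_pos] with ω hω
  refine propext ?_
  change ω ∈ exceedance V Zs F x h ↔ ω ∈ ⋃ i, _
  have hpos : ∀ i, 0 < ∑ k ∈ Finset.range (i + 1), V k ω := fun i =>
    Finset.sum_pos (fun k _ => hω k) (by simp)
  simp only [exceedance, maxStableField, Set.mem_ofPred_eq, lt_iSup_iff, Set.mem_iUnion]
  constructor
  · rintro ⟨p, hp, i, hi⟩
    refine ⟨i, (lt_maxRatio_iff hF (mul_pos hx (hpos i)).le).2 ⟨p, hp, ?_⟩⟩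
    have h1 := ((ENNReal.ofReal_lt_ofReal_iff').1 hi).1
    rw [inv_mul_eq_div, lt_div_iff₀ (hpos i)] at h1
    linarith
  · rintro ⟨i, hi⟩
    obtain ⟨p, hp, h1⟩ := (lt_maxRatio_iff hF (mul_pos hx (hpos i)).le).1 hi
    refine ⟨p, hp, i, (ENNReal.ofReal_lt_ofReal_iff_of_nonneg (mul_pos hx (hF p hp)).le).2 ?_⟩
    rw [inv_mul_eq_div, lt_div_iff₀ (hpos i)]
    linarith

/-- Independence and equality in law for the `i`-th point of the de Haan representation. -/
lemma IsDeHaanFamily.measure_lt_maxRatio [IsProbabilityMeasure P'] (hZ : ∀ t, Measurable (Z t))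
    (hV : IsDeHaanFamily P Z P' V Zs)
    (F : Finset ((Fin d → ℝ) × ℝ)) (x : ℝ) (h : Fin d → ℝ) (i : ℕ) :
    P' {ω | ENNReal.ofReal (x * ∑ k ∈ Finset.range (i + 1), V k ω) <
        maxRatio F h fun t => Zs i t ω} =
      ∫⁻ ω, P' {ω' | ENNReal.ofReal (x * ∑ k ∈ Finset.range (i + 1), V k ω') <
        maxRatio F h fun t => Z t ω} ∂P := by
  let S : Ω' → ℝ := fun ω => ∑ k ∈ Finset.range (i + 1), V k ω
  have hS : Measurable S := Finset.measurable_sum _ fun k _ => hV.measurable_exp k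
  have hZi : Measurable fun ω t => Zs i t ω := measurable_pi_iff.2 fun t => hV.measurable_copy i t
  have hZ' : Measurable fun ω t => Z t ω := measurable_pi_iff.2 hZ
  have hind : IndepFun (fun ω t => Zs i t ω) S P' := by
    have h1 : Measurable fun v : ℕ → ℝ => ∑ k ∈ Finset.range (i + 1), v k :=
      Finset.measurable_sum _ fun k _ => measurable_pi_apply k
    have h2 : Measurable fun z : ℕ → (Fin d → ℝ) → ℝ => z i := measurable_pi_apply i
    exact (hV.indep.comp h1 h2).symm
  have hmap := (indepFun_iff_map_prod_eq_prod_map_map hZi.aemeasurable hS.aemeasurable).1 hind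
  let A : Set (((Fin d → ℝ) → ℝ) × ℝ) := {p | ENNReal.ofReal (x * p.2) < maxRatio F h p.1}
  have hA : MeasurableSet A :=
    measurableSet_lt (by fun_prop) ((measurable_maxRatio F h).comp measurable_fst)
  have : IsProbabilityMeasure (P'.map S) := Measure.isProbabilityMeasure_map hS.aemeasurable
  calc _ = P'.map (fun ω => ((fun t => Zs i t ω), S ω)) A := by
        rw [Measure.map_apply (hZi.prodMk hS) hA]; rfl
    _ = ∫⁻ ω, P'.map S (Prod.mk (fun t => Z t ω) ⁻¹' A) ∂P := by
        rw [hmap, hV.law_copy i, Measure.prod_apply hA,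
          lintegral_map (measurable_measure_prodMk_left hA) hZ']
    _ = _ := by
        refine lintegral_congr fun ω => ?_
        rw [Measure.map_apply hS (measurable_prodMk_left hA)]
        rfl

/-- Union bound over the points `Γ_i`: given a maximal ratio `g`, the expected number of `Γ_i` below
`g / x` is at most `g / x`. -/
lemma IsDeHaanFamily.measure_exceedance_le [IsProbabilityMeasure P'] (hZ : ∀ t, Measurable (Z t))
    (hV : IsDeHaanFamily P Z P' V Zs) {F : Finset ((Fin d → ℝ) × ℝ)} (hF : ∀ p ∈ F, 0 < p.2)
    {x : ℝ} (hx : 0 < x) (h : Fin d → ℝ) :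
    ENNReal.ofReal x * P' (exceedance V Zs F x h) ≤ ∫⁻ ω, maxRatio F h (fun t => Z t ω) ∂P := by
  have hS : ∀ i, Measurable fun ω => ∑ k ∈ Finset.range (i + 1), V k ω := fun i =>
    Finset.measurable_sum _ fun k _ => hV.measurable_exp k
  have hZ' : Measurable fun ω t => Z t ω := measurable_pi_iff.2 hZ
  have hG : Measurable fun ω => maxRatio F h (fun t => Z t ω) := (measurable_maxRatio F h).comp hZ'
  have hx0 : ENNReal.ofReal x ≠ 0 := (ENNReal.ofReal_pos.2 hx).ne'
  have key : P' (exceedance V Zs F x h) ≤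
      ∫⁻ ω, (ENNReal.ofReal x)⁻¹ * maxRatio F h (fun t => Z t ω) ∂P := by
    rw [measure_congr (hV.exceedance_ae_eq hF hx h)]
    refine (measure_iUnion_le _).trans ?_
    simp_rw [hV.measure_lt_maxRatio hZ F x h]
    rw [← lintegral_tsum]
    · refine lintegral_mono fun ω => ?_
      set g := maxRatio F h (fun t => Z t ω) with hg
      have hgt : g ≠ ∞ := (maxRatio_lt_top _ _ _).ne
      calc _ ≤ ∑' i, P' {ω' | ∑ k ∈ Finset.range (i + 1), V k ω' < g.toReal / x} := by
            refine ENNReal.tsum_le_tsum fun i => measure_mono fun ω' hω' => ?_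
            simp only [Set.mem_ofPred_eq] at hω' ⊢
            rw [lt_div_iff₀ hx, mul_comm]
            rcases le_or_gt 0 (x * ∑ k ∈ Finset.range (i + 1), V k ω') with h0 | h0
            · exact (ENNReal.ofReal_lt_iff_lt_toReal h0 hgt).1 hω'
            · exact h0.trans_le ENNReal.toReal_nonneg
        _ ≤ ENNReal.ofReal (g.toReal / x) :=
            tsum_renewal_le hV.measurable_exp hV.law_exp hV.indep_exp _
        _ = _ := by
            rw [ENNReal.ofReal_div_of_pos hx, ENNReal.ofReal_toReal hgt, ENNReal.div_eq_inv_mul]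
    · intro i
      have hA : MeasurableSet {p : Ω × Ω' | ENNReal.ofReal
          (x * ∑ k ∈ Finset.range (i + 1), V k p.2) < maxRatio F h (fun t => Z t p.1)} :=
        measurableSet_lt (((hS i).comp measurable_snd).const_mul x).ennreal_ofReal
          (hG.comp measurable_fst)
      exact (measurable_measure_prodMk_left hA).aemeasurable
  calc _ ≤ ENNReal.ofReal x * ∫⁻ ω, (ENNReal.ofReal x)⁻¹ * maxRatio F h (fun t => Z t ω) ∂P := by
        gcongr
    _ = _ := by
        rw [lintegral_const_mul _ hG, ← mul_assoc, ENNReal.mul_inv_cancel hx0 ENNReal.ofReal_ne_top,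
          one_mul]

/-- Only the first point `Γ_0 = V 0` is kept. For large `x` this loses nothing in the limit, so it
matches the union bound without the exact Poisson formula. -/
lemma IsDeHaanFamily.le_measure_exceedance [IsProbabilityMeasure P'] (hZ : ∀ t, Measurable (Z t))
    (hV : IsDeHaanFamily P Z P' V Zs) {F : Finset ((Fin d → ℝ) × ℝ)} (hF : ∀ p ∈ F, 0 < p.2)
    {x : ℝ} (hx : 0 < x) (h : Fin d → ℝ) :
    ∫⁻ ω, ENNReal.ofReal ((maxRatio F h (fun t => Z t ω)).toReal /
        (1 + (maxRatio F h (fun t => Z t ω)).toReal / x)) ∂P ≤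
      ENNReal.ofReal x * P' (exceedance V Zs F x h) := by
  have key : ∫⁻ ω, ENNReal.ofReal ((maxRatio F h (fun t => Z t ω)).toReal / x /
        (1 + (maxRatio F h (fun t => Z t ω)).toReal / x)) ∂P ≤ P' (exceedance V Zs F x h) := by
    rw [measure_congr (hV.exceedance_ae_eq hF hx h)]
    refine le_trans ?_ (measure_mono (Set.subset_iUnion _ 0))
    rw [hV.measure_lt_maxRatio hZ F x h]
    refine lintegral_mono fun ω => ?_
    set g := maxRatio F h (fun t => Z t ω) with hg
    have hgt : g ≠ ∞ := (maxRatio_lt_top _ _ _).ne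
    refine (le_expMeasure_Iio (div_nonneg ENNReal.toReal_nonneg hx.le)).trans ?_
    rw [← hV.law_exp 0, Measure.map_apply (hV.measurable_exp 0) measurableSet_Iio]
    refine measure_mono_ae ?_
    filter_upwards [hV.ae_exp_pos] with ω' hω' h1
    have h1 : V 0 ω' < g.toReal / x := h1
    change ENNReal.ofReal (x * ∑ k ∈ Finset.range (0 + 1), V k ω') < g
    rw [ENNReal.ofReal_lt_iff_lt_toReal (by simpa using (mul_pos hx (hω' 0)).le) hgt]
    rw [lt_div_iff₀ hx] at h1
    simpa [mul_comm] using h1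
  refine le_trans ?_ (mul_le_mul_right key _)
  rw [← lintegral_const_mul' _ _ ENNReal.ofReal_ne_top]
  refine lintegral_mono fun ω => ?_
  rw [← ENNReal.ofReal_mul hx.le]
  refine (congrArg ENNReal.ofReal ?_).le
  field_simp

/-- Stationarity equates the exceedance probabilities at `h` and `h'`; the lower bound at `h` and
the upper bound at `h'` are then compared at levels `x = n + 1`, with Fatou's lemma as `n → ∞`. -/
lemma lintegral_maxRatio_le [IsProbabilityMeasure P'] (hZ : ∀ t, Measurable (Z t))
    (hV : IsDeHaanFamily P Z P' V Zs) (hX : IsStationary P' (maxStableField V Zs))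
    {F : Finset ((Fin d → ℝ) × ℝ)} (hF : ∀ p ∈ F, 0 < p.2) (h h' : Fin d → ℝ) :
    ∫⁻ ω, maxRatio F h (fun t => Z t ω) ∂P ≤ ∫⁻ ω, maxRatio F h' (fun t => Z t ω) ∂P := by
  have hG : Measurable fun ω => maxRatio F h (fun t => Z t ω) :=
    (measurable_maxRatio F h).comp (measurable_pi_iff.2 hZ)
  let u : ℕ → Ω → ℝ≥0∞ := fun n ω => ENNReal.ofReal ((maxRatio F h (fun t => Z t ω)).toReal /
        (1 + (maxRatio F h (fun t => Z t ω)).toReal / ((n : ℝ) + 1)))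
  have hu : ∀ n, ∫⁻ ω, u n ω ∂P ≤ ∫⁻ ω, maxRatio F h' (fun t => Z t ω) ∂P := fun n => by
    have hn : (0 : ℝ) < (n : ℝ) + 1 := by positivity
    refine (hV.le_measure_exceedance hZ hF hn h).trans ?_
    rw [hX.measure_exceedance F _ h, ← hX.measure_exceedance F _ h']
    exact hV.measure_exceedance_le hZ hF hn h'
  have hlim : ∀ ω, liminf (fun n => u n ω) atTop = maxRatio F h (fun t => Z t ω) := fun ω => by
    refine Tendsto.liminf_eq ?_
    have hgt : maxRatio F h (fun t => Z t ω) ≠ ∞ := (maxRatio_lt_top _ _ _).ne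
    rw [← ENNReal.ofReal_toReal hgt]
    refine ENNReal.tendsto_ofReal ?_
    have h1 : Tendsto (fun n : ℕ => 1 + (maxRatio F h (fun t => Z t ω)).toReal / ((n : ℝ) + 1))
        atTop (𝓝 (1 + 0)) := by
      refine tendsto_const_nhds.add (Tendsto.div_atTop tendsto_const_nhds ?_)
      exact tendsto_natCast_atTop_atTop.atTop_add tendsto_const_nhds
    have h2 := (tendsto_const_nhds (x := (maxRatio F h (fun t => Z t ω)).toReal)).div h1 (by simp)
    rwa [add_zero, div_one] at h2
  calc _ = ∫⁻ ω, liminf (fun n => u n ω) atTop ∂P := lintegral_congr fun ω => (hlim ω).symm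
    _ ≤ liminf (fun n => ∫⁻ ω, u n ω ∂P) atTop := by
        refine lintegral_liminf_le fun n => ?_
        exact (hG.ennreal_toReal.div ((hG.ennreal_toReal.div_const _).const_add 1)).ennreal_ofReal
    _ ≤ _ := by
        refine liminf_le_of_le (by isBoundedDefault) fun b hb => ?_
        obtain ⟨n, hn⟩ := hb.exists
        exact hn.trans (hu n)

lemma lintegral_maxRatio_eq [IsProbabilityMeasure P'] (hZ : ∀ t, Measurable (Z t))
    (hV : IsDeHaanFamily P Z P' V Zs) (hX : IsStationary P' (maxStableField V Zs))
    {F : Finset ((Fin d → ℝ) × ℝ)} (hF : ∀ p ∈ F, 0 < p.2) (h h' : Fin d → ℝ) :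
    ∫⁻ ω, maxRatio F h (fun t => Z t ω) ∂P = ∫⁻ ω, maxRatio F h' (fun t => Z t ω) ∂P :=
  (lintegral_maxRatio_le hZ hV hX hF h h').antisymm (lintegral_maxRatio_le hZ hV hX hF h' h)

end Stationary

end MaxStable

/-! ### The spectral measure and its shift invariance -/

section Spectral

variable {d : ℕ} {Ω : Type*} [MeasurableSpace Ω]

/-- The law of `X / s` under `P(dω) ds` on `Ω × (0, ∞)`. -/
def spectralMeasure (P : Measure Ω) (X : Ω → Path d) : Measure (Path d) :=
  (P.prod (volume.restrict (Set.Ioi (0 : ℝ)))).map fun p => scale p.2⁻¹ (X p.1)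

variable {P : Measure Ω} {X : Ω → Path d}

lemma measurable_scale_inv (hX : Measurable X) :
    Measurable fun p : Ω × ℝ => scale p.2⁻¹ (X p.1) :=
  measurable_scale.comp (measurable_snd.inv.prodMk (hX.comp measurable_fst))

instance [SFinite P] : SFinite (spectralMeasure P X) := by
  unfold spectralMeasure
  infer_instance

lemma spectralMeasure_apply (hX : Measurable X) {A : Set (Path d)}
    (hA : MeasurableSet A) :
    spectralMeasure P X A =
      ∫⁻ ω, volume (Set.Ioi 0 ∩ {s | scale s⁻¹ (X ω) ∈ A}) ∂P := by
  rw [spectralMeasure, Measure.map_apply (measurable_scale_inv hX) hA,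
    Measure.prod_apply (measurable_scale_inv hX hA)]
  refine lintegral_congr fun ω => ?_
  rw [Measure.restrict_apply' measurableSet_Ioi, Set.inter_comm]
  rfl

lemma ae_spectralMeasure_of [SFinite P] (hX : Measurable X) {p : Path d → Prop}
    (hp : MeasurableSet {f | p f}) (h : ∀ᵐ ω ∂P, ∀ s > 0, p (scale s⁻¹ (X ω))) :
    ∀ᵐ f ∂(spectralMeasure P X), p f := by
  rw [ae_iff]
  have h1 := spectralMeasure_apply (P := P) hX hp.compl
  rw [show {f | ¬ p f} = {f | p f}ᶜ from rfl, h1, lintegral_eq_zero_iff']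
  · filter_upwards [h] with ω hω
    have : Set.Ioi 0 ∩ {s : ℝ | scale s⁻¹ (X ω) ∈ {f | p f}ᶜ} = ∅ := by
      ext s
      simp only [Set.mem_inter_iff, Set.mem_Ioi, Set.mem_empty_iff_false, iff_false, not_and]
      exact fun hs h2 => h2 (hω s hs)
    rw [this]
    simp
  · have h2 : MeasurableSet {q : Ω × ℝ | q.2 ∈ Set.Ioi 0 ∧ scale q.2⁻¹ (X q.1) ∈ {f | p f}ᶜ} :=
      (measurable_snd measurableSet_Ioi).inter (measurable_scale_inv hX hp.compl)
    exact (measurable_measure_prodMk_left h2).aemeasurable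

lemma scale_inv_val {s : ℝ} (hs : 0 < s) (f : Path d) (t : Fin d → ℝ) :
    (scale s⁻¹ f).1 t = f.1 t / s := by
  change |s⁻¹| * f.1 t = f.1 t / s
  rw [abs_of_pos (inv_pos.2 hs), inv_mul_eq_div]

lemma lt_scale_inv_val {s : ℝ} (hs : 0 < s) (f : Path d) (t : Fin d → ℝ) :
    1 < (scale s⁻¹ f).1 t ↔ s < f.1 t := by
  rw [scale_inv_val hs, one_lt_div hs]

/-- Paths exceeding some level of `F`, shifted by `h`. -/
def exceedPaths (F : Finset ((Fin d → ℝ) × ℝ)) (h : Fin d → ℝ) : Set (Path d) :=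
  {f | ∃ p ∈ F, p.2 < f.1 (p.1 + h)}

lemma measurableSet_exceedPaths (F : Finset ((Fin d → ℝ) × ℝ)) (h : Fin d → ℝ) :
    MeasurableSet (exceedPaths F h) := by
  have : exceedPaths F h = ⋃ p ∈ F, {f | p.2 < f.1 (p.1 + h)} := by
    ext g
    simp [exceedPaths]
  rw [this]
  exact F.measurableSet_biUnion fun p _ =>
    measurableSet_lt measurable_const (measurable_eval _)

lemma volume_Ioi_inter_ofReal_lt (g : ℝ≥0∞) :
    volume (Set.Ioi 0 ∩ {s : ℝ | ENNReal.ofReal s < g}) = g := by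
  rcases eq_or_ne g ∞ with rfl | hg
  · simp
  have : Set.Ioi 0 ∩ {s : ℝ | ENNReal.ofReal s < g} = Set.Ioo 0 g.toReal := by
    ext s
    simp only [Set.mem_inter_iff, Set.mem_Ioi, Set.mem_ofPred_eq, Set.mem_Ioo]
    exact and_congr_right fun hs => ENNReal.ofReal_lt_iff_lt_toReal hs.le hg
  rw [this, Real.volume_Ioo, sub_zero, ENNReal.ofReal_toReal hg]

/-- For fixed `ω` the admissible `s` form the interval from `0` to the maximal ratio, whose length
is that ratio. -/
lemma spectralMeasure_exceedPaths (hX : Measurable X) {F : Finset ((Fin d → ℝ) × ℝ)}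
    (hF : ∀ p ∈ F, 0 < p.2) (h : Fin d → ℝ) :
    spectralMeasure P X (exceedPaths F h) = ∫⁻ ω, maxRatio F h (X ω).1 ∂P := by
  rw [spectralMeasure_apply hX (measurableSet_exceedPaths F h)]
  refine lintegral_congr fun ω => ?_
  rw [← volume_Ioi_inter_ofReal_lt (maxRatio F h (X ω).1)]
  congr 1
  ext s
  simp only [Set.mem_inter_iff, Set.mem_Ioi]
  refine and_congr_right fun hs => ?_
  change (∃ p ∈ F, p.2 < (scale s⁻¹ (X ω)).1 (p.1 + h)) ↔ ENNReal.ofReal s < maxRatio F h (X ω).1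
  rw [lt_maxRatio_iff hF hs.le]
  refine exists_congr fun p => and_congr_right fun _ => ?_
  rw [scale_inv_val hs, lt_div_iff₀ hs, mul_comm]

lemma lintegral_maxRatio_lt_top (hX : Measurable X)
    (hfin : ∀ t, ∫⁻ ω, ENNReal.ofReal ((X ω).1 t) ∂P < ∞) {F : Finset ((Fin d → ℝ) × ℝ)}
    (hF : ∀ p ∈ F, 0 < p.2) (h : Fin d → ℝ) :
    ∫⁻ ω, maxRatio F h (X ω).1 ∂P < ∞ := by
  have hm : ∀ t, Measurable fun ω => (X ω).1 t := fun t => (measurable_eval t).comp hX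
  calc _ ≤ ∫⁻ ω, ∑ p ∈ F, ENNReal.ofReal ((X ω).1 (p.1 + h) / p.2) ∂P :=
        lintegral_mono fun ω => show maxRatio F h (X ω).1 ≤ _ from iSup₂_le fun p hp =>
          Finset.single_le_sum (f := fun p : (Fin d → ℝ) × ℝ =>
            ENNReal.ofReal ((X ω).1 (p.1 + h) / p.2)) (fun _ _ => zero_le) hp
    _ = ∑ p ∈ F, ∫⁻ ω, ENNReal.ofReal ((X ω).1 (p.1 + h) / p.2) ∂P :=
        lintegral_finsetSum _ fun p _ => ((hm _).div_const _).ennreal_ofReal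
    _ < ∞ := by
        refine ENNReal.sum_lt_top.2 fun p hp => ?_
        simp_rw [ENNReal.ofReal_div_of_pos (hF p hp), div_eq_mul_inv]
        rw [lintegral_mul_const _ (hm _).ennreal_ofReal]
        exact ENNReal.mul_lt_top (hfin _) (by simpa using hF p hp)

/-- The paths that stay below the levels of some finite family with positive levels. -/
def belowSystem (d : ℕ) : Set (Set (Path d)) :=
  {A | ∃ F : Finset ((Fin d → ℝ) × ℝ), (∀ p ∈ F, 0 < p.2) ∧ A = (exceedPaths F 0)ᶜ}

lemma isPiSystem_belowSystem : IsPiSystem (belowSystem d) := by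
  classical
  rintro _ ⟨F, hF, rfl⟩ _ ⟨G, hG, rfl⟩ _
  refine ⟨F ∪ G, fun p hp => ?_, ?_⟩
  · rcases Finset.mem_union.1 hp with h | h
    exacts [hF p h, hG p h]
  · rw [← Set.compl_union]
    congr 1
    ext f
    simp only [exceedPaths, Set.mem_union, Set.mem_ofPred_eq, Finset.mem_union]
    grind

lemma generateFrom_belowSystem :
    (Subtype.instMeasurableSpace : MeasurableSpace (Path d)) =
      MeasurableSpace.generateFrom (belowSystem d) := by
  refine le_antisymm ?_ (MeasurableSpace.generateFrom_le ?_)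
  · refine Measurable.comap_le
      (m₁ := MeasurableSpace.generateFrom (belowSystem d)) (f := fun f : Path d => f.1) ?_
    refine (@measurable_pi_iff _ _ _ (MeasurableSpace.generateFrom (belowSystem d)) _ _).2
      fun t => ?_
    have hpos : ∀ y : ℝ, 0 < y →
        MeasurableSet[MeasurableSpace.generateFrom (belowSystem d)] {f : Path d | f.1 t ≤ y} := by
      intro y hy
      refine MeasurableSpace.measurableSet_generateFrom ⟨{(t, y)}, by simpa using hy, ?_⟩
      ext f
      simp [exceedPaths]
    refine @measurable_of_Iic _ _ _ _ _ (MeasurableSpace.generateFrom (belowSystem d)) _ _ _ _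
      fun y => ?_
    rcases lt_or_ge y 0 with hy | hy
    · have : (fun f : Path d => f.1 t) ⁻¹' Set.Iic y = ∅ := by
        ext f
        simpa using hy.trans_le (f.2.1 t)
      rw [this]
      exact @MeasurableSet.empty _ (MeasurableSpace.generateFrom (belowSystem d))
    -- The generating sets have positive levels only, so `y = 0` is reached from above.
    · have : (fun f : Path d => f.1 t) ⁻¹' Set.Iic y =
          ⋂ n : ℕ, {f : Path d | f.1 t ≤ y + 1 / ((n : ℝ) + 1)} := by
        ext f
        simp only [Set.mem_preimage, Set.mem_Iic, Set.mem_iInter, Set.mem_ofPred_eq]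
        refine ⟨fun h n => h.trans (le_add_of_nonneg_right (by positivity)), fun h => ?_⟩
        refine ge_of_tendsto' (x := atTop) (b := f.1 t) (a := y) ?_ h
        simpa using tendsto_const_nhds.add (tendsto_one_div_add_atTop_nhds_zero_nat (𝕜 := ℝ))
      rw [this]
      exact @MeasurableSet.iInter _ _ (MeasurableSpace.generateFrom (belowSystem d)) _ _
        fun n => hpos _ (add_pos_of_nonneg_of_pos hy (by positivity))
  · rintro _ ⟨F, -, rfl⟩
    exact (measurableSet_exceedPaths F 0).compl

/-- Paths exceeding `1 / (n + 1)` at the rational point `q`. -/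
def ratExceed (i : (Fin d → ℚ) × ℕ) : Set (Path d) :=
  {f | 1 / ((i.2 : ℝ) + 1) < f.1 fun j => (i.1 j : ℝ)}

lemma measurableSet_ratExceed (i : (Fin d → ℚ) × ℕ) : MeasurableSet (ratExceed i) :=
  measurableSet_lt measurable_const (measurable_eval _)

lemma mem_iUnion_ratExceed {f : Path d} : f ∈ ⋃ i, ratExceed i ↔ ∃ t, 0 < f.1 t := by
  simp only [Set.mem_iUnion]
  constructor
  · rintro ⟨i, hi⟩
    exact ⟨_, lt_trans (by positivity) hi⟩
  · rintro ⟨t, ht⟩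
    obtain ⟨q, hq⟩ := exists_rat_superlevel f ht
    obtain ⟨n, hn⟩ := exists_nat_one_div_lt hq
    exact ⟨(q, n), hn⟩

/-- Both measures may be infinite, so uniqueness on a π-system is applied to their restrictions to
the sets `ratExceed i`. These have finite mass, and countably many of them cover all paths that are
not identically zero. -/
theorem map_shift_spectralMeasure [SFinite P] (hX : Measurable X)
    (hinv : ∀ (F : Finset ((Fin d → ℝ) × ℝ)) (h : Fin d → ℝ), (∀ p ∈ F, 0 < p.2) →
      ∫⁻ ω, maxRatio F h (X ω).1 ∂P = ∫⁻ ω, maxRatio F 0 (X ω).1 ∂P)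
    (hfin : ∀ t, ∫⁻ ω, ENNReal.ofReal ((X ω).1 t) ∂P < ∞)
    (hpos : ∀ᵐ ω ∂P, ∃ t, 0 < (X ω).1 t) (h : Fin d → ℝ) :
    (spectralMeasure P X).map (shift h) = spectralMeasure P X := by
  classical
  set ν := spectralMeasure P X with hν
  have hup : ∀ F : Finset ((Fin d → ℝ) × ℝ), (∀ p ∈ F, 0 < p.2) →
      ν.map (shift h) (exceedPaths F 0) = ν (exceedPaths F 0) := fun F hF => by
    rw [Measure.map_apply (measurable_shift h) (measurableSet_exceedPaths F 0)]
    have : shift h ⁻¹' exceedPaths F 0 = exceedPaths F h := by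
      ext f
      simp [exceedPaths, shift]
    rw [this, spectralMeasure_exceedPaths hX hF, spectralMeasure_exceedPaths hX hF, hinv F h hF]
  have hupfin : ∀ F : Finset ((Fin d → ℝ) × ℝ), (∀ p ∈ F, 0 < p.2) → ν (exceedPaths F 0) < ∞ :=
    fun F hF => by
      rw [spectralMeasure_exceedPaths hX hF]
      exact lintegral_maxRatio_lt_top hX hfin hF 0
  have hS : ∀ i : (Fin d → ℚ) × ℕ, ratExceed i =
      exceedPaths {(fun j => (i.1 j : ℝ), 1 / ((i.2 : ℝ) + 1))} (0 : Fin d → ℝ) := fun i => by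
    ext f
    simp [ratExceed, exceedPaths]
  have hrestr : ∀ i : (Fin d → ℚ) × ℕ,
      (ν.map (shift h)).restrict (ratExceed i) = ν.restrict (ratExceed i) := by
    intro i
    set a : (Fin d → ℝ) × ℝ := (fun j => (i.1 j : ℝ), 1 / ((i.2 : ℝ) + 1)) with ha
    have ha0 : 0 < a.2 := by simp only [ha]; positivity
    -- Staying below `F` while exceeding `a` is a difference of two nested exceedance sets, whose
    -- masses are finite and already known to agree.
    have hval : ∀ F : Finset ((Fin d → ℝ) × ℝ), (∀ p ∈ F, 0 < p.2) →
        (exceedPaths F 0)ᶜ ∩ ratExceed i = exceedPaths (insert a F) 0 \ exceedPaths F 0 := by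
      intro F _
      ext f
      simp only [hS i, exceedPaths, Set.mem_inter_iff, Set.mem_compl_iff, Set.mem_sdiff,
        Set.mem_ofPred_eq, Finset.mem_insert, Finset.mem_singleton]
      grind
    have hmain : ∀ A ∈ belowSystem d,
        (ν.map (shift h)).restrict (ratExceed i) A = ν.restrict (ratExceed i) A := by
      rintro _ ⟨F, hF, rfl⟩
      have hF' : ∀ p ∈ insert a F, 0 < p.2 := by
        intro p hp
        rcases Finset.mem_insert.1 hp with rfl | hp
        exacts [ha0, hF p hp]
      have hsub : exceedPaths F (0 : Fin d → ℝ) ⊆ exceedPaths (insert a F) 0 := by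
        rintro f ⟨p, hp, h1⟩
        exact ⟨p, Finset.mem_insert_of_mem hp, h1⟩
      rw [Measure.restrict_apply' (measurableSet_ratExceed i),
        Measure.restrict_apply' (measurableSet_ratExceed i), hval F hF,
        measure_sdiff hsub (measurableSet_exceedPaths F 0).nullMeasurableSet (hupfin F hF).ne,
        measure_sdiff hsub (measurableSet_exceedPaths F 0).nullMeasurableSet
          (by rw [hup F hF]; exact (hupfin F hF).ne), hup F hF, hup _ hF']
    have huniv : Set.univ ∈ belowSystem d := ⟨∅, by simp, by ext; simp [exceedPaths]⟩
    have hfinS : IsFiniteMeasure ((ν.map (shift h)).restrict (ratExceed i)) := by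
      refine ⟨?_⟩
      rw [hmain _ huniv, Measure.restrict_apply_univ, hS i]
      refine hupfin _ fun p hp => ?_
      rw [Finset.mem_singleton.1 hp]
      exact ha0
    exact ext_of_generate_finite _ generateFrom_belowSystem isPiSystem_belowSystem hmain
      (hmain _ huniv)
  have hmU : MeasurableSet (⋃ i, ratExceed (d := d) i) := .iUnion measurableSet_ratExceed
  have hae : ∀ᵐ f ∂ν, f ∈ ⋃ i, ratExceed i := by
    refine ae_spectralMeasure_of hX hmU ?_
    filter_upwards [hpos] with ω ⟨t, ht⟩ s hs
    refine mem_iUnion_ratExceed.2 ⟨t, ?_⟩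
    rw [scale_inv_val hs]
    exact div_pos ht hs
  have hae' : ∀ᵐ f ∂(ν.map (shift h)), f ∈ ⋃ i, ratExceed i := by
    refine (ae_map_iff (measurable_shift h).aemeasurable hmU).2 ?_
    filter_upwards [hae] with f hf
    obtain ⟨t, ht⟩ := mem_iUnion_ratExceed.1 hf
    exact mem_iUnion_ratExceed.2 ⟨t - h, by simpa [shift] using ht⟩
  have hcongr := Measure.restrict_iUnion_congr.2 hrestr
  rwa [Measure.restrict_eq_self_of_ae_mem hae, Measure.restrict_eq_self_of_ae_mem hae'] at hcongr

end Spectral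

/-! ### The law of `R Θ` as a restricted spectral measure -/

section Tilted

variable {d : ℕ}

lemma image_const_div_Ioo {c : ℝ} (hc : 0 < c) : (fun s => c / s) '' Set.Ioo 0 c = Set.Ioi 1 := by
  ext r
  simp only [Set.mem_image, Set.mem_Ioo, Set.mem_Ioi]
  constructor
  · rintro ⟨s, ⟨hs, hsc⟩, rfl⟩
    exact (one_lt_div hs).2 hsc
  · intro hr
    have hr0 : 0 < r := one_pos.trans hr
    exact ⟨c / r, ⟨div_pos hc hr0, div_lt_self hc hr⟩, by field_simp⟩

/-- The substitution `r = c / s` in the unit Pareto law. -/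
lemma mul_paretoMeasure_eq {c : ℝ} (hc : 0 < c) {B : Set ℝ} (hB : MeasurableSet B) :
    ENNReal.ofReal c * paretoMeasure 1 1 B = volume (Set.Ioo 0 c ∩ {s | c / s ∈ B}) := by
  have h1 : paretoMeasure 1 1 B =
      ∫⁻ r in Set.Ioi 1, ENNReal.ofReal (r ^ 2)⁻¹ * B.indicator 1 r := by
    have h2 : paretoMeasure 1 1 = volume.withDensity (paretoPDF 1 1) := rfl
    rw [h2, withDensity_apply _ hB, ← lintegral_indicator hB, setLIntegral_congr Ioi_ae_eq_Ici,
      ← lintegral_indicator measurableSet_Ici]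
    refine lintegral_congr fun r => ?_
    by_cases hr : 1 ≤ r
    · have h3 : paretoPDF 1 1 r = ENNReal.ofReal (r ^ 2)⁻¹ := by
        rw [paretoPDF_of_le hr, Real.rpow_neg (by linarith)]
        norm_num
      by_cases hrB : r ∈ B <;> simp [hr, hrB, h3]
    · have h4 : paretoPDF 1 1 r = 0 := paretoPDF_of_lt (not_le.1 hr)
      by_cases hrB : r ∈ B <;> simp [hr, hrB, h4]
  have hBs : MeasurableSet {s : ℝ | c / s ∈ B} := (measurable_const.div measurable_id) hB
  have hder : ∀ s ∈ Set.Ioo 0 c, HasDerivWithinAt (fun s => c / s) (-(c / s ^ 2)) (Set.Ioo 0 c) s := by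
    intro s hs
    have h := ((hasDerivAt_inv hs.1.ne').const_mul c).hasDerivWithinAt (s := Set.Ioo 0 c)
    refine (h.congr_deriv ?_).congr (fun u _ => div_eq_mul_inv c u) (div_eq_mul_inv c s)
    rw [div_eq_mul_inv, mul_neg]
  have hinj : Set.InjOn (fun s => c / s) (Set.Ioo 0 c) := by
    intro s hs u hu h
    have h : c / s = c / u := h
    have hs0 := hs.1.ne'
    have hu0 := hu.1.ne'
    field_simp at h
    exact h.symm
  rw [h1, ← image_const_div_Ioo hc,
    lintegral_image_eq_lintegral_abs_deriv_mul measurableSet_Ioo hder hinj,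
    ← lintegral_const_mul' _ _ ENNReal.ofReal_ne_top, Set.inter_comm,
    ← Measure.restrict_apply' measurableSet_Ioo, ← lintegral_indicator_one hBs]
  refine setLIntegral_congr_fun measurableSet_Ioo fun s hs => ?_
  have hs0 := hs.1.ne'
  have h5 : ENNReal.ofReal c * (ENNReal.ofReal |-(c / s ^ 2)| * ENNReal.ofReal ((c / s) ^ 2)⁻¹)
      = 1 := by
    rw [abs_neg, abs_of_pos (div_pos hc (pow_pos hs.1 2)),
      ← ENNReal.ofReal_mul (div_pos hc (pow_pos hs.1 2)).le, ← ENNReal.ofReal_mul hc.le,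
      ← ENNReal.ofReal_one]
    congr 1
    field_simp
  change ENNReal.ofReal c * (ENNReal.ofReal |-(c / s ^ 2)| *
    (ENNReal.ofReal ((c / s) ^ 2)⁻¹ * B.indicator 1 (c / s))) = _
  rw [← mul_assoc (ENNReal.ofReal |_|), ← mul_assoc, h5, one_mul]
  rfl

lemma ae_paretoMeasure_one_le : ∀ᵐ r ∂(paretoMeasure 1 1), 1 ≤ r := by
  have h2 : paretoMeasure 1 1 = volume.withDensity (paretoPDF 1 1) := rfl
  rw [ae_iff, show {r : ℝ | ¬ 1 ≤ r} = Set.Iio 1 by ext; simp, h2,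
    withDensity_apply _ measurableSet_Iio, lintegral_paretoPDF_of_le le_rfl]

section

variable {Ω Ω₂ : Type*} [MeasurableSpace Ω] [MeasurableSpace Ω₂] {P : Measure Ω}
  {P₂ : Measure Ω₂} {Z : (Fin d → ℝ) → Ω → ℝ} {Θ : (Fin d → ℝ) → Ω₂ → ℝ} {R : Ω₂ → ℝ}

/-- The law of `R Θ` is the spectral measure restricted to the paths exceeding `1` at `0`. -/
theorem map_eq_restrict_spectralMeasure [IsProbabilityMeasure P] [IsProbabilityMeasure P₂]
    (hZ : ∀ t, Measurable (Z t)) {X : Ω → Path d} (hX : Measurable X)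
    (hXZ : ∀ᵐ ω ∂P, (X ω).1 = fun t => Z t ω)
    (hΘ : IsTilted P Z P₂ Θ) (hRm : Measurable R) (hR : P₂.map R = paretoMeasure 1 1)
    (hRΘ : IndepFun R (fun ω t => Θ t ω) P₂) {W : Ω₂ → Path d} (hW : Measurable W)
    (hWY : ∀ᵐ ω ∂P₂, (W ω).1 = fun t => R ω * Θ t ω) :
    P₂.map W = (spectralMeasure P X).restrict {f | 1 < f.1 0} := by
  have hΘm : Measurable fun ω t => Θ t ω := measurable_pi_iff.2 hΘ.measurable
  have hQm : Measurable fun ω t => Z t ω / Z 0 ω :=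
    measurable_pi_iff.2 fun t => (hZ t).div (hZ 0)
  have hmS : MeasurableSet {f : Path d | 1 < f.1 0} :=
    measurableSet_lt measurable_const (measurable_eval 0)
  have hpar : IsProbabilityMeasure (paretoMeasure 1 1) := by
    rw [← hR]
    exact Measure.isProbabilityMeasure_map hRm.aemeasurable
  have hmap := (indepFun_iff_map_prod_eq_prod_map_map hΘm.aemeasurable hRm.aemeasurable).1 hRΘ.symm
  rw [hR, hΘ.law] at hmap
  ext A hA
  obtain ⟨B, hB, rfl⟩ := hA
  have hA : MeasurableSet (Subtype.val ⁻¹' B : Set (Path d)) := measurable_subtype_coe hB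
  let D : Set (((Fin d → ℝ) → ℝ) × ℝ) := {p | (fun t => p.2 * p.1 t) ∈ B}
  have hD : MeasurableSet D := by
    refine (measurable_pi_iff.2 fun t => ?_) hB
    exact measurable_snd.mul ((measurable_pi_apply t).comp measurable_fst)
  have hlow : P₂.map W (Subtype.val ⁻¹' B) = P₂.map (fun ω => ((fun t => Θ t ω), R ω)) D := by
    rw [Measure.map_apply hW hA, Measure.map_apply (hΘm.prodMk hRm) hD]
    refine measure_congr ?_
    filter_upwards [hWY] with ω hω
    change ((W ω).1 ∈ B) = ((fun t => R ω * Θ t ω) ∈ B)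
    rw [hω]
  have hsec := measurable_measure_prodMk_left (ν := paretoMeasure 1 1) hD
  have hsecQ : Measurable fun ω => paretoMeasure 1 1 (Prod.mk (fun t => Z t ω / Z 0 ω) ⁻¹' D) :=
    hsec.comp hQm
  rw [hlow, hmap, Measure.prod_apply hD, lintegral_map hsec hQm,
    lintegral_withDensity_eq_lintegral_mul _ (hZ 0).ennreal_ofReal hsecQ,
    Measure.restrict_apply' hmS, spectralMeasure_apply hX (hA.inter hmS)]
  refine lintegral_congr_ae ?_
  filter_upwards [hXZ] with ω hω
  have hset : Set.Ioi 0 ∩ {s | scale s⁻¹ (X ω) ∈ Subtype.val ⁻¹' B ∩ {f | 1 < f.1 0}} =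
      Set.Ioo 0 (Z 0 ω) ∩ {s | (fun t => Z t ω / s) ∈ B} := by
    ext s
    simp only [Set.mem_inter_iff, Set.mem_Ioi, Set.mem_ofPred_eq, Set.mem_preimage, Set.mem_Ioo,
      and_assoc]
    refine and_congr_right fun hs => ?_
    have h1 : (scale s⁻¹ (X ω)).1 = fun t => Z t ω / s := by
      ext t
      rw [scale_inv_val hs, hω]
    rw [lt_scale_inv_val hs, h1, hω, and_comm]
  rw [hset]
  have h0 : 0 ≤ Z 0 ω := by
    have := (X ω).2.1 0
    rwa [hω] at this
  -- If `Z 0 ω = 0`, the tilting density and the interval of levels both vanish; the junk quotient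
  -- `Z t ω / 0` plays no role.
  rcases h0.eq_or_lt with h0 | h0
  · simp [← h0]
  · have hBm : MeasurableSet {r : ℝ | (fun t => r * (Z t ω / Z 0 ω)) ∈ B} :=
      (measurable_pi_iff.2 fun t => measurable_id.mul_const _) hB
    have := mul_paretoMeasure_eq h0 hBm
    simp only [Pi.mul_apply]
    refine this.trans ?_
    congr 1
    ext s
    simp only [Set.mem_inter_iff, Set.mem_ofPred_eq]
    refine and_congr_right fun hs => ?_
    have h2 : (fun t => Z 0 ω / s * (Z t ω / Z 0 ω)) = fun t => Z t ω / s := by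
      ext t
      have := hs.1.ne'
      field_simp
    rw [h2]

end

end Tilted

/-! ### Sojourns, level sets and lattice mass transport -/

section Grid

variable {d : ℕ}

lemma gridMeasure_zero : gridMeasure d 0 = volume := by simp [gridMeasure]

lemma gridMeasure_of_ne {δ : ℝ} (hδ : δ ≠ 0) : gridMeasure d δ = ENNReal.ofReal (δ ^ d) •
    Measure.sum fun k : Fin d → ℤ => Measure.dirac fun i => δ * (k i : ℝ) := by
  simp [gridMeasure, hδ]

instance (δ : ℝ) : SFinite (gridMeasure d δ) := by
  unfold gridMeasure
  split_ifs <;> infer_instance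

lemma gridMeasure_apply {δ : ℝ} (hδ : δ ≠ 0) (A : Set (Fin d → ℝ)) :
    gridMeasure d δ A = ENNReal.ofReal (δ ^ d) *
      ∑' k : Fin d → ℤ, A.indicator 1 fun i => δ * (k i : ℝ) := by
  rw [gridMeasure_of_ne hδ, Measure.smul_apply, Measure.sum_apply_of_countable, smul_eq_mul]
  simp only [Measure.dirac_apply]

lemma ae_mem_grid (δ : ℝ) : ∀ᵐ t ∂(gridMeasure d δ), t ∈ grid d δ := by
  rcases eq_or_ne δ 0 with rfl | hδ
  · exact .of_forall fun t => Or.inl rfl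
  · rw [gridMeasure_of_ne hδ]
    refine Measure.ae_smul_measure ?_ _
    refine Measure.ae_sum_iff.2 fun k => ?_
    rw [ae_dirac_eq]
    exact Or.inr ⟨k, rfl⟩

lemma sojourn_eq (δ : ℝ) (A : Set (Fin d → ℝ)) (f : (Fin d → ℝ) → ℝ) (s : ℝ) :
    sojourn δ A f s = gridMeasure d δ (A ∩ {t | s < f t}) := by
  refine measure_congr ?_
  filter_upwards [ae_mem_grid δ] with t ht
  refine propext ?_
  change (t ∈ A ∩ grid d δ ∧ s < f t) ↔ t ∈ A ∧ s < f t
  simp [ht]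

lemma gridMeasure_preimage_add {δ : ℝ} {h : Fin d → ℝ} (hh : h ∈ grid d δ)
    (A : Set (Fin d → ℝ)) : gridMeasure d δ ((fun t => t + h) ⁻¹' A) = gridMeasure d δ A := by
  rcases eq_or_ne δ 0 with rfl | hδ
  · rw [gridMeasure_zero]
    exact measure_preimage_add_right _ _ _
  · obtain ⟨m, rfl⟩ := hh.resolve_left hδ
    rw [gridMeasure_apply hδ, gridMeasure_apply hδ]
    congr 1
    rw [← (Equiv.addRight m).tsum_eq fun k : Fin d → ℤ =>
      A.indicator (1 : (Fin d → ℝ) → ℝ≥0∞) fun i => δ * (k i : ℝ)]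
    refine tsum_congr fun k => ?_
    have : (fun i => δ * (k i : ℝ)) + (fun i => δ * (m i : ℝ)) =
        fun i => δ * (((Equiv.addRight m) k i : ℤ) : ℝ) := by
      ext i
      simp [mul_add]
    rw [← this]
    rfl

/-- The sojourn above `1` of a path in `A`. -/
def sojournIn (δ : ℝ) (A : Set (Fin d → ℝ)) (f : Path d) : ℝ≥0∞ :=
  gridMeasure d δ (A ∩ {t | 1 < f.1 t})

lemma measurableSet_exceed_uncurry :
    MeasurableSet {p : Path d × (Fin d → ℝ) | 1 < p.1.1 p.2} :=
  measurableSet_lt measurable_const measurable_eval_uncurry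

lemma measurable_sojournIn (δ : ℝ) {A : Set (Fin d → ℝ)} (hA : MeasurableSet A) :
    Measurable (sojournIn δ A : Path d → ℝ≥0∞) :=
  measurable_measure_prodMk_left (s := {p : Path d × (Fin d → ℝ) | p.2 ∈ A ∧ 1 < p.1.1 p.2})
    ((measurable_snd hA).inter measurableSet_exceed_uncurry)

lemma sojournIn_mono (δ : ℝ) {A B : Set (Fin d → ℝ)} (h : A ⊆ B) (f : Path d) :
    sojournIn δ A f ≤ sojournIn δ B f :=
  measure_mono (Set.inter_subset_inter_left _ h)

lemma sojournIn_shift {δ : ℝ} {h : Fin d → ℝ} (hh : h ∈ grid d δ) (A : Set (Fin d → ℝ))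
    (f : Path d) : sojournIn δ ((fun t => t + h) ⁻¹' A) (shift h f) = sojournIn δ A f :=
  gridMeasure_preimage_add hh (A ∩ {t | 1 < f.1 t})

lemma sojourn_scale {δ s : ℝ} (hs : 0 < s) (A : Set (Fin d → ℝ)) (f : Path d) :
    sojournIn δ A (scale s⁻¹ f) = sojourn δ A f.1 s := by
  rw [sojourn_eq, sojournIn]
  simp only [lt_scale_inv_val hs]

lemma epsilon_eq (δ : ℝ) (f : Path d) : epsilon δ f.1 = sojournIn δ Set.univ f :=
  sojourn_eq _ _ _ _

/-- For a continuous function, superlevel sets of finite volume determine the level. -/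
lemma subsingleton_level_of_volume (hd : 1 ≤ d) {g : (Fin d → ℝ) → ℝ} (hg : Continuous g)
    {x : ℝ≥0∞} (hx : x ≠ ∞) : {s | s < g 0 ∧ volume {t | s < g t} = x}.Subsingleton := by
  -- For `d = 0` the whole space has volume one and the claim fails; here it has infinite volume.
  have : Nonempty (Fin d) := ⟨⟨0, hd⟩⟩
  have key : ∀ s s', s < s' → s' < g 0 → volume {t | s < g t} = x → volume {t | s' < g t} = x →
      False := by
    intro s s' hss hs' h h'
    have hsub : {t | s' < g t} ⊆ {t | s < g t} := fun t ht => hss.trans ht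
    have hdiff : volume ({t | s < g t} \ {t | s' < g t}) = 0 := by
      rw [measure_sdiff hsub (isOpen_lt continuous_const hg).measurableSet.nullMeasurableSet
        (by rw [h']; exact hx), h, h', tsub_self]
    have hempty : {t | s < g t ∧ g t < s'} = ∅ := by
      by_contra hne
      have hopen : IsOpen {t | s < g t ∧ g t < s'} :=
        (isOpen_lt continuous_const hg).inter (isOpen_lt hg continuous_const)
      refine (hopen.measure_pos volume (Set.nonempty_iff_ne_empty.2 hne)).ne' ?_
      refine measure_mono_null (fun t ht => ?_) hdiff
      exact ⟨ht.1, fun h => lt_asymm h ht.2⟩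
    -- Since `g 0 > s'`, a value at most `s` would force the intermediate value `(s + s') / 2`,
    -- which lies in the empty band. So `g > s` everywhere, against finiteness of `x`.
    have hall : ∀ t, s < g t := by
      intro t
      by_contra ht
      obtain ⟨u, hu⟩ := mem_range_of_exists_le_of_exists_ge hg (c := (s + s') / 2)
        ⟨t, by linarith⟩ ⟨0, by linarith⟩
      have : u ∈ {t | s < g t ∧ g t < s'} := ⟨by rw [hu]; linarith, by rw [hu]; linarith⟩
      rw [hempty] at this
      exact this
    refine hx ?_
    rw [← h, show {t | s < g t} = Set.univ from Set.eq_univ_of_forall hall]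
    exact measure_univ_of_isAddLeftInvariant _
  intro s hs s' hs'
  rcases lt_trichotomy s s' with h | h | h
  · exact (key s s' h hs'.1 hs.2 hs'.2).elim
  · exact h
  · exact (key s' s h hs.1 hs'.2 hs.2).elim

/-- The cell of the lattice `δ ℤ^d` with lower corner `δ k`. -/
def cell (δ : ℝ) (k : Fin d → ℤ) : Set (Fin d → ℝ) := {t | ∀ i, ⌊t i / δ⌋ = k i}

lemma measurableSet_cell (δ : ℝ) (k : Fin d → ℤ) : MeasurableSet (cell δ k) := by
  have : cell δ k = ⋂ i, {t | ⌊t i / δ⌋ = k i} := by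
    ext t
    simp [cell]
  rw [this]
  refine .iInter fun i => ?_
  have h : Measurable fun t : Fin d → ℝ => ⌊t i / δ⌋ :=
    Int.measurable_floor.comp ((by fun_prop : Measurable fun t : Fin d → ℝ => t i / δ))
  exact h (measurableSet_singleton (k i))

lemma pairwise_disjoint_cell (δ : ℝ) : Pairwise (Function.onFun Disjoint (cell (d := d) δ)) := by
  intro k l hkl
  refine Set.disjoint_left.2 fun t hk hl => hkl ?_
  ext i
  rw [← hk i, ← hl i]

lemma tsum_volume_cell_inter_le (δ : ℝ) (f : Path d) :
    ∑' k, volume (cell δ k ∩ {t | 1 < f.1 t}) ≤ volume {t | 1 < f.1 t} := by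
  rw [← measure_iUnion]
  · exact measure_mono (Set.iUnion_subset fun k => Set.inter_subset_right)
  · exact fun k l h => (pairwise_disjoint_cell δ h).mono Set.inter_subset_left
      Set.inter_subset_left
  · exact fun k => (measurableSet_cell δ k).inter (measurableSet_superlevel f 1)

/-- Continuity from the upper right octant supplies a small cube of exceedances with lower corner
`0`, inside the cell of the origin. -/
lemma volume_cell_inter_pos {δ : ℝ} (hδ : 0 < δ) {f : Path d} (h : 1 < f.1 0) :
    0 < volume (cell δ 0 ∩ {t | 1 < f.1 t}) := by
  obtain ⟨ε, hε, hb⟩ := exists_box_superlevel f h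
  have hsub : Set.pi Set.univ (fun _ : Fin d => Set.Ioo 0 (min ε δ)) ⊆
      cell δ 0 ∩ {t | 1 < f.1 t} := by
    intro t ht
    have ht' : ∀ i, 0 < t i ∧ t i < min ε δ := fun i => ht i trivial
    refine ⟨fun i => ?_, hb t fun i => ⟨(ht' i).1.le, ?_⟩⟩
    · rw [Pi.zero_apply, Int.floor_eq_zero_iff]
      exact ⟨div_nonneg (ht' i).1.le hδ.le,
        (div_lt_one hδ).2 ((ht' i).2.trans_le (min_le_right _ _))⟩
    · simpa using (ht' i).2.trans_le (min_le_left _ _)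
  refine lt_of_lt_of_le ?_ (measure_mono hsub)
  rw [volume_pi_pi]
  simp [hε, hδ, Finset.prod_const, pos_iff_ne_zero]

/-- Mass transport: a path in a shift-invariant measure with finite positive excursion volume has
finitely many lattice exceedances. -/
theorem ae_tsum_lattice_lt_top {ν : Measure (Path d)} (hinv : ∀ h, ν.map (shift h) = ν)
    (hν : ν {f | 1 < f.1 0} < ∞) (hfin : ∀ᵐ f ∂ν, volume {t | 1 < f.1 t} < ∞)
    {δ : ℝ} (hδ : 0 < δ) :
    ∀ᵐ f ∂ν, 1 < f.1 0 →
      ∑' k : Fin d → ℤ, {t | 1 < f.1 t}.indicator (1 : (Fin d → ℝ) → ℝ≥0∞)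
        (fun i => δ * (k i : ℝ)) < ∞ := by
  let e : (Fin d → ℤ) → Path d → ℝ≥0∞ := fun k f =>
    {t | 1 < f.1 t}.indicator 1 fun i => δ * (k i : ℝ)
  let w : (Fin d → ℤ) → Path d → ℝ≥0∞ := fun k f => volume (cell δ k ∩ {t | 1 < f.1 t})
  let W : Path d → ℝ≥0∞ := fun f => volume {t | 1 < f.1 t}
  have he : ∀ k, Measurable (e k) := fun k => by
    have : e k = {f | 1 < f.1 fun i => δ * (k i : ℝ)}.indicator 1 := by
      ext f
      simp [e, Set.indicator_apply]
    rw [this]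
    exact measurable_one.indicator (measurableSet_lt measurable_const (measurable_eval _))
  have hw : ∀ k, Measurable (w k) := fun k =>
    measurable_measure_prodMk_left
      (s := {p : Path d × (Fin d → ℝ) | p.2 ∈ cell δ k ∧ 1 < p.1.1 p.2})
      ((measurable_snd (measurableSet_cell δ k)).inter measurableSet_exceed_uncurry)
  have hW : Measurable W := measurable_measure_prodMk_left measurableSet_exceed_uncurry
  have hshift : ∀ (j : Fin d → ℤ) (f : Path d),
      e j (shift (fun i => δ * ((-j) i : ℤ)) f) = e 0 f ∧
      w 0 (shift (fun i => δ * ((-j) i : ℤ)) f) = w (-j) f ∧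
      W (shift (fun i => δ * ((-j) i : ℤ)) f) = W f := by
    intro j f
    set h : Fin d → ℝ := fun i => δ * ((-j) i : ℤ) with hh
    refine ⟨?_, ?_, measure_preimage_add_right volume h {t | 1 < f.1 t}⟩
    · have : (fun i => δ * (j i : ℝ)) + h = fun i => δ * ((0 : Fin d → ℤ) i : ℝ) := by
        ext i
        simp [hh]
      simp only [e, Set.indicator_apply, Set.mem_ofPred_eq, shift, this, Pi.one_apply]
    · have : cell δ 0 ∩ {t | 1 < (shift h f).1 t} =
          (fun t => t + h) ⁻¹' (cell δ (-j) ∩ {t | 1 < f.1 t}) := by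
        ext t
        refine and_congr_left fun _ => forall_congr' fun i => ?_
        have h1 : (t + h) i / δ = t i / δ + ((-j) i : ℤ) := by
          simp only [Pi.add_apply, hh]
          field_simp
        rw [h1, Int.floor_add_intCast]
        simp
      simp only [w]
      rw [this]
      exact measure_preimage_add_right volume h _
  have hmul : ∀ i j, Measurable fun f => e i f * (w j f / W f) := fun i j =>
    (he i).mul ((hw j).div hW)
  -- Each exceeding lattice point `j` sends mass `w k / W` to cell `k`. The integrand is the mass
  -- received by cell `0`; by invariance its integral equals that of the mass sent from `0`, which
  -- is at most `ν {f | 1 < f.1 0}`.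
  have hbound : ∫⁻ f, ∑' j, e j f * (w 0 f / W f) ∂ν < ∞ := by
    rw [lintegral_tsum fun j => (hmul j 0).aemeasurable]
    have h1 : ∀ j, ∫⁻ f, e j f * (w 0 f / W f) ∂ν = ∫⁻ f, e 0 f * (w (-j) f / W f) ∂ν := by
      intro j
      conv_lhs => rw [← hinv (fun i => δ * ((-j) i : ℤ))]
      rw [lintegral_map (hmul j 0) (measurable_shift _)]
      refine lintegral_congr fun f => ?_
      obtain ⟨a, b, c⟩ := hshift j f
      rw [a, b, c]
    simp_rw [h1]
    rw [← lintegral_tsum fun j => (hmul 0 (-j)).aemeasurable]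
    refine lt_of_le_of_lt (lintegral_mono fun f => ?_) (?_ : ∫⁻ f, e 0 f ∂ν < ∞)
    · rw [ENNReal.tsum_mul_left]
      simp_rw [div_eq_mul_inv]
      rw [ENNReal.tsum_mul_right,
        show ∑' j, w (-j) f = ∑' j, w j f from (Equiv.neg (Fin d → ℤ)).tsum_eq fun j => w j f]
      have h2 : (∑' j, w j f) * (W f)⁻¹ ≤ 1 :=
        (mul_le_mul_left (tsum_volume_cell_inter_le δ f) _).trans (ENNReal.mul_inv_le_one (W f))
      simpa using mul_le_mul_right h2 (e 0 f)
    · have : e 0 = {f | 1 < f.1 0}.indicator 1 := by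
        ext f
        have h0 : (fun i => δ * (((0 : Fin d → ℤ) i : ℤ) : ℝ)) = 0 := by
          ext i
          simp
        simp only [e, h0]
        rfl
      rw [this, lintegral_indicator_one (measurableSet_lt measurable_const (measurable_eval 0))]
      exact hν
  have hm : Measurable fun f => ∑' j, e j f * (w 0 f / W f) :=
    Measurable.tsum fun j => hmul j 0
  filter_upwards [ae_lt_top hm hbound.ne, hfin] with f h1 h2 h3
  rw [ENNReal.tsum_mul_right] at h1
  -- The received mass is the number of lattice exceedances times this factor, so a non-zero factor
  -- makes the number finite.
  have hpos : w 0 f / W f ≠ 0 := ENNReal.div_ne_zero.2 ⟨(volume_cell_inter_pos hδ h3).ne', h2.ne⟩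
  exact ENNReal.lt_top_of_mul_ne_top_left h1.ne hpos

/-! ### The grid measure of boxes -/

/-- The box `[a, b]^d`. -/
def box (d : ℕ) (a b : ℝ) : Set (Fin d → ℝ) := Set.Icc (fun _ => a) (fun _ => b)

lemma measurableSet_box (a b : ℝ) : MeasurableSet (box d a b) := measurableSet_Icc

lemma mem_box {a b : ℝ} {t : Fin d → ℝ} : t ∈ box d a b ↔ ∀ i, a ≤ t i ∧ t i ≤ b :=
  ⟨fun h i => ⟨h.1 i, h.2 i⟩, fun h => ⟨fun i => (h i).1, fun i => (h i).2⟩⟩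

lemma volume_box (a b : ℝ) : volume (box d a b) = ENNReal.ofReal (b - a) ^ d := by
  rw [box, Real.volume_Icc_pi]
  simp

lemma gridMeasure_box {δ : ℝ} (hδ : 0 < δ) (a b : ℝ) :
    gridMeasure d δ (box d a b) =
      ENNReal.ofReal (δ ^ d) * ((⌊b / δ⌋ + 1 - ⌈a / δ⌉).toNat : ℝ≥0∞) ^ d := by
  classical
  rw [gridMeasure_apply hδ.ne']
  congr 1
  have hmem : ∀ k : Fin d → ℤ, (fun i => δ * (k i : ℝ)) ∈ box d a b ↔
      k ∈ Fintype.piFinset fun _ : Fin d => Finset.Icc ⌈a / δ⌉ ⌊b / δ⌋ := by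
    intro k
    simp only [mem_box, Fintype.mem_piFinset, Finset.mem_Icc, Int.ceil_le, Int.le_floor,
      div_le_iff₀ hδ, le_div_iff₀ hδ, mul_comm δ]
  rw [tsum_eq_sum (s := Fintype.piFinset fun _ : Fin d => Finset.Icc ⌈a / δ⌉ ⌊b / δ⌋)]
  · rw [Finset.sum_congr rfl (g := fun _ => (1 : ℝ≥0∞)) fun k hk =>
      Set.indicator_of_mem ((hmem k).2 hk) _]
    simp
  · exact fun k hk => Set.indicator_of_notMem (fun h => hk ((hmem k).1 h)) _

/-- Each side `[a, b]` contains at most `(b - a) / δ + 1` multiples of `δ`; the correction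
disappears after division by `T ^ d`. -/
lemma gridMeasure_box_le {δ : ℝ} (hδ : 0 ≤ δ) {a b : ℝ} (hab : a ≤ b) :
    gridMeasure d δ (box d a b) ≤ ENNReal.ofReal ((b - a + δ) ^ d) := by
  rw [ENNReal.ofReal_pow (by linarith)]
  rcases hδ.eq_or_lt with rfl | hδ
  · rw [gridMeasure_zero, volume_box, add_zero]
  · rw [gridMeasure_box hδ, ENNReal.ofReal_pow hδ.le, ← mul_pow]
    gcongr
    rw [← ENNReal.ofReal_natCast, ← ENNReal.ofReal_mul hδ.le]
    refine ENNReal.ofReal_le_ofReal ?_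
    have h1 : ((⌊b / δ⌋ + 1 - ⌈a / δ⌉).toNat : ℝ) ≤ (b - a) / δ + 1 := by
      have h2 : ((⌊b / δ⌋ + 1 - ⌈a / δ⌉ : ℤ) : ℝ) ≤ (b - a) / δ + 1 := by
        push_cast
        rw [sub_div]
        linarith [Int.floor_le (b / δ), Int.le_ceil (a / δ)]
      have h3 : (0 : ℝ) ≤ (b - a) / δ + 1 := by
        have := div_nonneg (sub_nonneg.2 hab) hδ.le
        linarith
      rw [← Int.cast_natCast, Int.toNat_eq_max, Int.cast_max]
      exact max_le h2 (by simpa using h3)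
    calc _ ≤ δ * ((b - a) / δ + 1) := by gcongr
      _ = _ := by field_simp

lemma le_gridMeasure_box {δ : ℝ} (hδ : 0 ≤ δ) {a b : ℝ} (hab : δ ≤ b - a) :
    ENNReal.ofReal ((b - a - δ) ^ d) ≤ gridMeasure d δ (box d a b) := by
  rw [ENNReal.ofReal_pow (by linarith)]
  rcases hδ.eq_or_lt with rfl | hδ
  · rw [gridMeasure_zero, volume_box, sub_zero]
  · rw [gridMeasure_box hδ, ENNReal.ofReal_pow hδ.le, ← mul_pow]
    gcongr
    rw [← ENNReal.ofReal_natCast, ← ENNReal.ofReal_mul hδ.le]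
    refine ENNReal.ofReal_le_ofReal ?_
    have h1 : (b - a) / δ - 1 ≤ ((⌊b / δ⌋ + 1 - ⌈a / δ⌉).toNat : ℝ) := by
      have h2 : (b - a) / δ - 1 ≤ ((⌊b / δ⌋ + 1 - ⌈a / δ⌉ : ℤ) : ℝ) := by
        push_cast
        rw [sub_div]
        linarith [Int.lt_floor_add_one (b / δ), Int.ceil_lt_add_one (a / δ)]
      refine h2.trans ?_
      rw [← Int.cast_natCast]
      exact_mod_cast Int.self_le_toNat _
    calc _ = δ * ((b - a) / δ - 1) := by field_simp
      _ ≤ _ := by gcongr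

lemma tendsto_sub_div_pow (c : ℝ) :
    Tendsto (fun T : ℝ => ENNReal.ofReal ((T - c) ^ d) / ENNReal.ofReal (T ^ d)) atTop (𝓝 1) := by
  have h1 : Tendsto (fun T : ℝ => ENNReal.ofReal ((1 - c / T) ^ d)) atTop (𝓝 1) := by
    have h2 : Tendsto (fun T : ℝ => (1 - c / T) ^ d) atTop (𝓝 ((1 - 0) ^ d)) :=
      ((tendsto_const_nhds).sub (tendsto_const_nhds.div_atTop tendsto_id)).pow d
    simpa using ENNReal.tendsto_ofReal h2
  refine h1.congr' ?_
  filter_upwards [eventually_gt_atTop 0] with T hT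
  rw [← ENNReal.ofReal_div_of_pos (pow_pos hT d), ← div_pow, sub_div, div_self hT.ne']

lemma tendsto_gridMeasure_box {δ : ℝ} (hδ : 0 ≤ δ) (a c : ℝ) :
    Tendsto (fun T => gridMeasure d δ (box d a (T - c)) / ENNReal.ofReal (T ^ d)) atTop (𝓝 1) := by
  refine tendsto_of_tendsto_of_tendsto_of_le_of_le' (tendsto_sub_div_pow (d := d) (c + a + δ))
    (tendsto_sub_div_pow (d := d) (c + a - δ)) ?_ ?_
  · filter_upwards [eventually_ge_atTop (c + a + δ)] with T hT
    have := le_gridMeasure_box (d := d) hδ (a := a) (b := T - c) (by linarith)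
    rw [show T - c - a - δ = T - (c + a + δ) by ring] at this
    gcongr
  · filter_upwards [eventually_ge_atTop (c + a)] with T hT
    have := gridMeasure_box_le (d := d) hδ (a := a) (b := T - c) (by linarith)
    rw [show T - c - a + δ = T - (c + a - δ) by ring] at this
    gcongr

end Grid

/-! ### Asymptotics of the Berman ratio -/

section Limits

variable {d : ℕ}

open Classical in
/-- `l⁻¹` on the event that the sojourn `l` is larger than `x`. -/
def truncInv (x l : ℝ≥0∞) : ℝ≥0∞ := if x < l then l⁻¹ else 0

lemma measurable_truncInv (x : ℝ≥0∞) : Measurable (truncInv x) :=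
  Measurable.ite measurableSet_Ioi measurable_inv measurable_const

lemma truncInv_le_inv (x l : ℝ≥0∞) : truncInv x l ≤ x⁻¹ := by
  unfold truncInv
  split_ifs with h
  · exact ENNReal.inv_le_inv.2 h.le
  · exact zero_le

section Transport

variable {ν : Measure (Path d)} [SFinite ν]

/-- Averaging over the exceedance points and shifting them to the origin. -/
lemma measure_lt_sojournIn (hinv : ∀ h, ν.map (shift h) = ν) {δ : ℝ} (x : ℝ≥0∞)
    {A : Set (Fin d → ℝ)} (hA : MeasurableSet A) (hfin : gridMeasure d δ A < ∞) :
    ν {f | x < sojournIn δ A f} = ∫⁻ t in A, ∫⁻ f in {f | 1 < f.1 0},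
      truncInv x (sojournIn δ ((fun u => u + t) ⁻¹' A) f) ∂ν ∂(gridMeasure d δ) := by
  have hS := measurable_sojournIn (d := d) δ hA
  have hm0 : MeasurableSet {f : Path d | 1 < f.1 0} :=
    measurableSet_lt measurable_const (measurable_eval 0)
  let G : Path d → (Fin d → ℝ) → ℝ≥0∞ := fun f t =>
    {t | 1 < f.1 t}.indicator (fun _ => truncInv x (sojournIn δ A f)) t
  have hG : Measurable (Function.uncurry G) := by
    have : Function.uncurry G = {p : Path d × (Fin d → ℝ) | 1 < p.1.1 p.2}.indicator
        fun p => truncInv x (sojournIn δ A p.1) := by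
      ext p
      rfl
    rw [this]
    exact (((measurable_truncInv x).comp hS).comp measurable_fst).indicator
      measurableSet_exceed_uncurry
  -- Here `l⁻¹ * l = 1` needs `0 < l < ∞`: the first follows from `x < l`, the second from the
  -- finite grid measure of `A`.
  have h1 : ∀ f, {f | x < sojournIn δ A f}.indicator (1 : Path d → ℝ≥0∞) f =
      ∫⁻ t in A, G f t ∂(gridMeasure d δ) := by
    intro f
    rw [lintegral_indicator (measurableSet_superlevel f 1), setLIntegral_const,
      Measure.restrict_apply (measurableSet_superlevel f 1), Set.inter_comm]
    change _ = truncInv x (sojournIn δ A f) * sojournIn δ A f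
    by_cases h : x < sojournIn δ A f
    · rw [Set.indicator_of_mem (by exact h), truncInv, if_pos h, ENNReal.inv_mul_cancel]
      · rfl
      · exact (zero_le.trans_lt h).ne'
      · exact ((measure_mono Set.inter_subset_left).trans_lt hfin).ne
    · rw [Set.indicator_of_notMem (by exact h), truncInv, if_neg h, zero_mul]
  have h2 : ∀ t ∈ grid d δ, ∫⁻ f, G f t ∂ν = ∫⁻ f in {f | 1 < f.1 0},
      truncInv x (sojournIn δ ((fun u => u + t) ⁻¹' A) f) ∂ν := by
    intro t ht
    have hm : Measurable ({f : Path d | 1 < f.1 0}.indicator fun f =>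
        truncInv x (sojournIn δ ((fun u => u + t) ⁻¹' A) f)) :=
      ((measurable_truncInv x).comp
        (measurable_sojournIn δ ((measurable_id.add_const t) hA))).indicator hm0
    rw [← lintegral_indicator hm0]
    conv_rhs => rw [← hinv t]
    rw [lintegral_map hm (measurable_shift t)]
    refine lintegral_congr fun f => ?_
    simp only [G, Set.indicator_apply, Set.mem_ofPred_eq]
    rw [sojournIn_shift ht]
    simp [shift]
  rw [← lintegral_indicator_one (measurableSet_lt measurable_const hS)]
  simp_rw [h1]
  rw [lintegral_lintegral_swap hG.aemeasurable]
  refine lintegral_congr_ae (ae_restrict_of_ae ?_)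
  filter_upwards [ae_mem_grid δ] with t ht using h2 t ht

end Transport

lemma box_subset_preimage {M T : ℝ} {t : Fin d → ℝ} (ht : t ∈ box d M (T - M)) :
    box d (-M) M ⊆ (fun u => u + t) ⁻¹' box d 0 T := by
  intro u hu
  rw [mem_box] at ht hu
  refine mem_box.2 fun i => ?_
  have := ht i
  have := hu i
  simp only [Pi.add_apply]
  constructor <;> linarith

/-- The limiting value `E[1(ε > x) / ε]` of the Berman ratio. -/
def limitValue (ν : Measure (Path d)) (δ : ℝ) (x : ℝ≥0∞) : ℝ≥0∞ :=
  ∫⁻ f in {f | 1 < f.1 0}, truncInv x (sojournIn δ Set.univ f) ∂ν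

lemma tendsto_sojournIn_box (δ : ℝ) (f : Path d) :
    Tendsto (fun M : ℕ => sojournIn δ (box d (-M) M) f) atTop (𝓝 (sojournIn δ Set.univ f)) := by
  have hmono : Monotone fun M : ℕ => box d (-M) M ∩ {t | 1 < f.1 t} := by
    intro M N h t ht
    have h' : (M : ℝ) ≤ N := by exact_mod_cast h
    refine ⟨mem_box.2 fun i => ?_, ht.2⟩
    have := mem_box.1 ht.1 i
    constructor <;> linarith
  have hU : ⋃ M : ℕ, box d (-M) M ∩ {t | 1 < f.1 t} = Set.univ ∩ {t | 1 < f.1 t} := by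
    rw [← Set.iUnion_inter]
    congr 1
    refine Set.eq_univ_of_forall fun t => Set.mem_iUnion.2 ?_
    obtain ⟨M, hM⟩ := exists_nat_ge ‖t‖
    refine ⟨M, mem_box.2 fun i => ?_⟩
    have := abs_le.1 ((Real.norm_eq_abs _ ▸ norm_le_pi_norm t i).trans hM)
    exact this
  have := tendsto_measure_iUnion_atTop (μ := gridMeasure d δ) hmono
  rwa [hU] at this

section Limit

variable {ν : Measure (Path d)} {δ : ℝ} {x : ℝ≥0∞}

/-- The Berman ratio of the spectral measure. -/
def ratio (ν : Measure (Path d)) (δ : ℝ) (x : ℝ≥0∞) (T : ℝ) : ℝ≥0∞ :=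
  ν {f | x < sojournIn δ (box d 0 T) f} / ENNReal.ofReal (T ^ d)

lemma gridMeasure_box_lt_top (hδ : 0 ≤ δ) (a b : ℝ) : gridMeasure d δ (box d a b) < ∞ := by
  have h : box d a b ⊆ box d a (max a b) := fun t ht => mem_box.2 fun i =>
    ⟨(mem_box.1 ht i).1, (mem_box.1 ht i).2.trans (le_max_right _ _)⟩
  exact (measure_mono h).trans_lt
    ((gridMeasure_box_le hδ (le_max_left _ _)).trans_lt ENNReal.ofReal_lt_top)

/-- Points of `[M, T - M]^d` see a window containing `[-M, M]^d`. Testing `x < l` on that small box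
and inverting the total sojourn bounds the integrand from below; then `T → ∞`, and `M → ∞` by
monotone convergence. No bound on `1 / l` is needed, so `x = δ = 0` is included. -/
lemma limitValue_le_liminf [SFinite ν] (hinv : ∀ h, ν.map (shift h) = ν) (hδ : 0 ≤ δ) :
    limitValue ν δ x ≤ liminf (ratio ν δ x) atTop := by
  classical
  let lb : ℕ → Path d → ℝ≥0∞ := fun M f =>
    if x < sojournIn δ (box d (-M) M) f then (sojournIn δ Set.univ f)⁻¹ else 0
  have hlb : ∀ M, Measurable (lb M) := fun M =>
    Measurable.ite (measurableSet_lt measurable_const (measurable_sojournIn δ (measurableSet_box _ _)))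
      (measurable_sojournIn δ .univ).inv measurable_const
  have hstep : ∀ M : ℕ, ∫⁻ f in {f | 1 < f.1 0}, lb M f ∂ν ≤ liminf (ratio ν δ x) atTop := by
    intro M
    set c := ∫⁻ f in {f | 1 < f.1 0}, lb M f ∂ν with hc
    have hlim : Tendsto (fun T : ℝ => c * (gridMeasure d δ (box d M (T - M)) /
        ENNReal.ofReal (T ^ d))) atTop (𝓝 (c * 1)) :=
      ENNReal.Tendsto.const_mul (tendsto_gridMeasure_box hδ M M) (Or.inl one_ne_zero)
    rw [mul_one] at hlim
    rw [← hlim.liminf_eq]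
    refine liminf_le_liminf (.of_forall fun T => ?_)
    rw [ratio, ← mul_div_assoc]
    gcongr
    rw [measure_lt_sojournIn hinv x (measurableSet_box 0 T) (gridMeasure_box_lt_top hδ 0 T)]
    have hsub : box d (M : ℝ) (T - M) ⊆ box d 0 T := fun t ht => mem_box.2 fun i => by
      have := mem_box.1 ht i
      have hM : (0 : ℝ) ≤ M := by positivity
      constructor <;> linarith
    refine le_trans ?_ (lintegral_mono_set hsub)
    rw [← setLIntegral_const]
    refine setLIntegral_mono' (measurableSet_box _ _) fun t ht => ?_
    rw [hc]
    refine lintegral_mono fun f => ?_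
    have h1 := sojournIn_mono δ (box_subset_preimage ht) f
    have h2 := sojournIn_mono δ (Set.subset_univ ((fun u => u + t) ⁻¹' box d 0 T)) f
    simp only [lb, truncInv]
    split_ifs with h3 h4
    · exact ENNReal.inv_le_inv.2 h2
    · exact (h4 (h3.trans_le h1)).elim
    · exact zero_le
    · exact zero_le
  refine le_of_tendsto' (x := atTop) ?_ hstep
  have hmono : Monotone lb := by
    intro M N h f
    have hsub : box d (-(M : ℝ)) M ⊆ box d (-N) N := fun t ht => mem_box.2 fun i => by
      have := mem_box.1 ht i
      have h' : (M : ℝ) ≤ N := by exact_mod_cast h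
      constructor <;> linarith
    have h1 := sojournIn_mono δ hsub f
    simp only [lb]
    split_ifs with h3 h4
    · exact le_rfl
    · exact (h4 (h3.trans_le h1)).elim
    · exact zero_le
    · exact zero_le
  refine lintegral_tendsto_of_tendsto_of_monotone (fun M => (hlb M).aemeasurable)
    (.of_forall fun f M N h => hmono h f) (.of_forall fun f => ?_)
  simp only [lb, truncInv]
  split_ifs with h
  · refine tendsto_const_nhds.congr' ?_
    filter_upwards [(tendsto_sojournIn_box δ f).eventually (lt_mem_nhds h)] with M hM
    rw [if_pos hM]
  · refine tendsto_const_nhds.congr fun M => ?_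
    rw [if_neg fun h' => h (h'.trans_le (sojournIn_mono δ (Set.subset_univ _) f))]

/-- The roles are exchanged: `x < l` is tested on the total sojourn and the sojourn in `[-M, M]^d`
is inverted. The constant `C` controls the boundary points, whose share of the cube vanishes, and
dominates the integrands as `M → ∞`. -/
lemma limsup_le_limitValue [SFinite ν] (hinv : ∀ h, ν.map (shift h) = ν)
    (hν : ν {f | 1 < f.1 0} = 1) (hδ : 0 ≤ δ) {C : ℝ≥0∞} (hC : C ≠ ∞)
    (hbound : ∀ A : Set (Fin d → ℝ), 0 ∈ A → ∀ f : Path d, 1 < f.1 0 →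
      truncInv x (sojournIn δ A f) ≤ C) :
    limsup (ratio ν δ x) atTop ≤ limitValue ν δ x := by
  classical
  have hm0 : MeasurableSet {f : Path d | 1 < f.1 0} :=
    measurableSet_lt measurable_const (measurable_eval 0)
  let ub : ℕ → Path d → ℝ≥0∞ := fun M f =>
    if x < sojournIn δ Set.univ f then min C (sojournIn δ (box d (-M) M) f)⁻¹ else 0
  have hub : ∀ M, Measurable (ub M) := fun M =>
    Measurable.ite (measurableSet_lt measurable_const (measurable_sojournIn δ .univ))
      (measurable_const.min (measurable_sojournIn δ (measurableSet_box _ _)).inv) measurable_const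
  have hubC : ∀ M f, ub M f ≤ C := fun M f => by
    simp only [ub]
    split_ifs
    exacts [min_le_left _ _, zero_le]
  have hint : ∀ g : Path d → ℝ≥0∞, (∀ f, 1 < f.1 0 → g f ≤ C) →
      ∫⁻ f in {f | 1 < f.1 0}, g f ∂ν ≤ C := fun g hg =>
    (setLIntegral_mono' hm0 fun f hf => hg f hf).trans_eq (by rw [setLIntegral_const, hν, mul_one])
  have hstep : ∀ M : ℕ, limsup (ratio ν δ x) atTop ≤ ∫⁻ f in {f | 1 < f.1 0}, ub M f ∂ν := by
    intro M
    set c := ∫⁻ f in {f | 1 < f.1 0}, ub M f ∂ν with hc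
    let a : ℝ → ℝ≥0∞ := fun T => gridMeasure d δ (box d M (T - M)) / ENNReal.ofReal (T ^ d)
    let b : ℝ → ℝ≥0∞ := fun T => gridMeasure d δ (box d 0 (T - 0)) / ENNReal.ofReal (T ^ d)
    have ha : Tendsto a atTop (𝓝 1) := tendsto_gridMeasure_box hδ M M
    have hb : Tendsto b atTop (𝓝 1) := tendsto_gridMeasure_box hδ 0 0
    have hlim : Tendsto (fun T => c * a T + C * (b T - a T)) atTop (𝓝 (c * 1 + C * (1 - 1))) :=
      (ENNReal.Tendsto.const_mul ha (Or.inl one_ne_zero)).add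
        (ENNReal.Tendsto.const_mul (ENNReal.Tendsto.sub hb ha (Or.inl ENNReal.one_ne_top))
          (Or.inr hC))
    rw [tsub_self, mul_zero, add_zero, mul_one] at hlim
    rw [← hlim.limsup_eq]
    refine limsup_le_limsup ?_
    filter_upwards [eventually_gt_atTop 0] with T hT
    have hsub : box d (M : ℝ) (T - M) ⊆ box d 0 T := fun t ht => mem_box.2 fun i => by
      have := mem_box.1 ht i
      have hM : (0 : ℝ) ≤ M := by positivity
      constructor <;> linarith
    have hdiv : b T - a T = gridMeasure d δ (box d 0 T \ box d M (T - M)) /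
        ENNReal.ofReal (T ^ d) := by
      rw [measure_sdiff hsub (measurableSet_box _ _).nullMeasurableSet
        (gridMeasure_box_lt_top hδ _ _).ne, ENNReal.sub_div]
      · simp only [a, b, sub_zero]
      · simp [pow_pos hT]
    simp only [hdiv, a, ratio]
    rw [← mul_div_assoc, ← mul_div_assoc, ENNReal.div_add_div_same]
    gcongr
    rw [measure_lt_sojournIn hinv x (measurableSet_box 0 T) (gridMeasure_box_lt_top hδ 0 T),
      ← lintegral_inter_add_sdiff _ (box d 0 T) (measurableSet_box (M : ℝ) (T - M)),
      Set.inter_eq_right.2 hsub, ← setLIntegral_const, ← setLIntegral_const]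
    refine add_le_add ?_ ?_
    · refine setLIntegral_mono' (measurableSet_box _ _) fun t ht => ?_
      refine setLIntegral_mono' hm0 fun f hf => ?_
      have h1 := sojournIn_mono δ (box_subset_preimage ht) f
      have h2 := sojournIn_mono δ (Set.subset_univ ((fun u => u + t) ⁻¹' box d 0 T)) f
      have h3 : (0 : Fin d → ℝ) ∈ (fun u => u + t) ⁻¹' box d 0 T := by
        simpa using hsub ht
      have h4 := hbound _ h3 f hf
      simp only [ub]
      split_ifs with h5
      · refine le_min h4 ?_
        unfold truncInv
        split_ifs
        exacts [ENNReal.inv_le_inv.2 h1, zero_le]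
      · rw [truncInv, if_neg fun h => h5 (h.trans_le h2)]
    · refine setLIntegral_mono' ((measurableSet_box _ _).diff (measurableSet_box _ _)) fun t ht => ?_
      refine hint _ fun f hf => hbound _ ?_ f hf
      simpa using ht.1
  have hlim : Tendsto (fun M => ∫⁻ f in {f | 1 < f.1 0}, ub M f ∂ν) atTop
      (𝓝 (∫⁻ f in {f | 1 < f.1 0}, if x < sojournIn δ Set.univ f then
        min C (sojournIn δ Set.univ f)⁻¹ else 0 ∂ν)) := by
    refine tendsto_lintegral_of_dominated_convergence (fun _ => C) hub
      (fun M => .of_forall (hubC M)) ?_ (.of_forall fun f => ?_)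
    · rw [setLIntegral_const, hν, mul_one]
      exact hC
    · simp only [ub]
      split_ifs with h
      · exact tendsto_const_nhds.min (tendsto_sojournIn_box δ f).inv
      · exact tendsto_const_nhds
  refine (ge_of_tendsto' hlim hstep).trans (lintegral_mono fun f => ?_)
  unfold truncInv
  split_ifs
  exacts [min_le_right _ _, le_rfl]

lemma gridMeasure_zero_singleton_le (hδ : 0 < δ) : ENNReal.ofReal (δ ^ d) ≤
    gridMeasure d δ {(0 : Fin d → ℝ)} := by
  rw [gridMeasure_apply hδ.ne']
  refine le_mul_of_one_le_right zero_le ?_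
  refine le_trans ?_ (ENNReal.le_tsum (0 : Fin d → ℤ))
  have : (fun i => δ * (((0 : Fin d → ℤ) i : ℤ) : ℝ)) = 0 := by
    ext i
    simp
  rw [this]
  simp

/-- A deterministic bound for `1(l > x) / l`, available unless `x = δ = 0`. -/
lemma exists_truncInv_bound (h : 0 < x ∨ 0 < δ) : ∃ C : ℝ≥0∞, C ≠ ∞ ∧
    ∀ A : Set (Fin d → ℝ), 0 ∈ A → ∀ f : Path d, 1 < f.1 0 →
      truncInv x (sojournIn δ A f) ≤ C := by
  rcases h with h | h
  · exact ⟨x⁻¹, by simpa using h.ne', fun A _ f _ => truncInv_le_inv _ _⟩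
  -- The origin is itself an exceedance and contributes `δ ^ d` to the sojourn.
  · refine ⟨(ENNReal.ofReal (δ ^ d))⁻¹, by simpa using pow_pos h d, fun A hA f hf => ?_⟩
    unfold truncInv
    split_ifs
    · refine ENNReal.inv_le_inv.2 ((gridMeasure_zero_singleton_le h).trans (measure_mono ?_))
      rintro _ rfl
      exact ⟨hA, hf⟩
    · exact zero_le

lemma limitValue_lt_top (hν : ν {f | 1 < f.1 0} = 1) (h : 0 < x ∨ 0 < δ) :
    limitValue ν δ x < ∞ := by
  obtain ⟨C, hC, hb⟩ := exists_truncInv_bound (d := d) h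
  have hm0 : MeasurableSet {f : Path d | 1 < f.1 0} :=
    measurableSet_lt measurable_const (measurable_eval 0)
  refine lt_of_le_of_lt (setLIntegral_mono' hm0 fun f hf => hb _ (Set.mem_univ 0) f hf) ?_
  rw [setLIntegral_const, hν, mul_one]
  exact hC.lt_top

lemma limitValue_pos (h : 0 < ν {f | 1 < f.1 0 ∧ x < sojournIn δ Set.univ f ∧
    sojournIn δ Set.univ f < ∞}) : 0 < limitValue ν δ x := by
  have hm : Measurable fun f : Path d => truncInv x (sojournIn δ Set.univ f) :=
    (measurable_truncInv x).comp (measurable_sojournIn δ .univ)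
  rw [limitValue, setLIntegral_pos_iff hm]
  refine h.trans_le (measure_mono fun f hf => ⟨?_, hf.1⟩)
  rw [Function.mem_support, truncInv, if_pos hf.2.1]
  exact ENNReal.inv_ne_zero.2 hf.2.2.ne

/-! ### The subadditive case `x = δ = 0` -/

lemma exists_cell_of_mem_box {m T : ℝ} (hm : 0 < m) {t : Fin d → ℝ} (ht : t ∈ box d 0 T) :
    ∃ k : Fin d → Fin (⌊T / m⌋₊ + 1),
      t ∈ (fun u => u + fun i => -(m * (k i : ℕ))) ⁻¹' box d 0 m := by
  rw [mem_box] at ht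
  have hk : ∀ i, ⌊t i / m⌋₊ < ⌊T / m⌋₊ + 1 := fun i =>
    Nat.lt_succ_of_le (Nat.floor_le_floor (div_le_div_of_nonneg_right (ht i).2 hm.le))
  refine ⟨fun i => ⟨⌊t i / m⌋₊, hk i⟩, mem_box.2 fun i => ?_⟩
  have h1 := Nat.floor_le (div_nonneg (ht i).1 hm.le)
  have h2 := Nat.lt_floor_add_one (t i / m)
  rw [le_div_iff₀ hm] at h1
  rw [div_lt_iff₀ hm] at h2
  simp only [Pi.add_apply]
  constructor <;> linarith

/-- Translates of `[0,m]^d` cover `[0,T]^d`, and a positive sojourn in the union forces one in some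
translate; invariance gives all translates the same mass. -/
lemma measure_pos_sojournIn_le (hinv : ∀ h, ν.map (shift h) = ν) {m T : ℝ} (hm : 0 < m) :
    ν {f | 0 < sojournIn 0 (box d 0 T) f} ≤
      ((⌊T / m⌋₊ + 1 : ℕ) : ℝ≥0∞) ^ d * ν {f | 0 < sojournIn 0 (box d 0 m) f} := by
  let h : (Fin d → Fin (⌊T / m⌋₊ + 1)) → Fin d → ℝ := fun k i => -(m * (k i : ℕ))
  have hsub : {f : Path d | 0 < sojournIn 0 (box d 0 T) f} ⊆
      ⋃ k, {f | 0 < sojournIn 0 ((fun u => u + h k) ⁻¹' box d 0 m) f} := by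
    intro f hf
    by_contra hne
    simp only [Set.mem_iUnion, Set.mem_ofPred_eq, not_exists, not_lt, nonpos_iff_eq_zero] at hne
    have hf : 0 < sojournIn 0 (box d 0 T) f := hf
    refine hf.ne' ?_
    refine measure_mono_null ?_ (measure_iUnion_null hne)
    intro t ht
    obtain ⟨k, hk⟩ := exists_cell_of_mem_box hm ht.1
    exact Set.mem_iUnion.2 ⟨k, hk, ht.2⟩
  have heq : ∀ k, ν {f | 0 < sojournIn 0 ((fun u => u + h k) ⁻¹' box d 0 m) f} =
      ν {f | 0 < sojournIn 0 (box d 0 m) f} := by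
    intro k
    have hmA : MeasurableSet ((fun u => u + h k) ⁻¹' box d 0 m) :=
      (measurable_id.add_const _) (measurableSet_box _ _)
    conv_lhs => rw [← hinv (h k)]
    rw [Measure.map_apply (measurable_shift _)
      (measurableSet_lt measurable_const (measurable_sojournIn 0 hmA))]
    congr 1
    ext f
    change 0 < sojournIn 0 _ (shift (h k) f) ↔ 0 < sojournIn 0 _ f
    rw [sojournIn_shift (Or.inl rfl)]
  refine (measure_mono hsub).trans ((measure_iUnion_fintype_le _ _).trans_eq ?_)
  simp_rw [heq]
  simp

lemma limsup_ratio_zero_le (hinv : ∀ h, ν.map (shift h) = ν) {m : ℝ}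
    (hm : 0 < m) : limsup (ratio ν 0 0) atTop ≤ ratio ν 0 0 m := by
  have hlim : Tendsto (fun T : ℝ => (ENNReal.ofReal ((T - -m) ^ d) / ENNReal.ofReal (T ^ d)) *
      ratio ν 0 0 m) atTop (𝓝 (1 * ratio ν 0 0 m)) :=
    ENNReal.Tendsto.mul_const (tendsto_sub_div_pow (-m)) (Or.inl one_ne_zero)
  rw [one_mul] at hlim
  rw [← hlim.limsup_eq]
  refine limsup_le_limsup ?_
  filter_upwards [eventually_gt_atTop 0] with T hT
  have h1 : (((⌊T / m⌋₊ + 1 : ℕ) : ℝ≥0∞)) ^ d ≤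
      ENNReal.ofReal ((T - -m) ^ d) / ENNReal.ofReal (m ^ d) := by
    rw [← ENNReal.ofReal_div_of_pos (pow_pos hm d), ← div_pow, ENNReal.ofReal_pow
      (div_nonneg (by linarith) hm.le), ← ENNReal.ofReal_natCast]
    gcongr
    push_cast
    rw [sub_neg_eq_add, add_div, div_self hm.ne']
    linarith [Nat.floor_le (div_nonneg hT.le hm.le)]
  rw [ratio]
  calc _ ≤ (ENNReal.ofReal ((T - -m) ^ d) / ENNReal.ofReal (m ^ d) *
        ν {f | 0 < sojournIn 0 (box d 0 m) f}) / ENNReal.ofReal (T ^ d) := by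
        gcongr
        exact (measure_pos_sojournIn_le hinv hm).trans (by gcongr)
    _ = _ := by
        rw [ratio]
        simp only [div_eq_mul_inv]
        ring

/-- As in Fekete's lemma, the limit is the infimum of the ratios over `m > 0`. -/
lemma tendsto_ratio_zero (hinv : ∀ h, ν.map (shift h) = ν)
    (hfin : ν {f | 0 < sojournIn 0 (box d 0 1) f} < ∞) :
    ∃ l < ∞, Tendsto (ratio ν 0 0) atTop (𝓝 l) := by
  have hr : ratio ν 0 0 1 < ∞ := ENNReal.div_lt_top hfin.ne (by simp)
  refine ⟨⨅ m > 0, ratio ν 0 0 m, (iInf₂_le 1 one_pos).trans_lt hr, ?_⟩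
  refine tendsto_of_le_liminf_of_limsup_le ?_ ?_
  · refine le_liminf_of_le (by isBoundedDefault) ?_
    filter_upwards [eventually_gt_atTop 0] with T hT using iInf₂_le T hT
  · exact le_iInf₂ fun m hm => limsup_ratio_zero_le hinv hm

theorem exists_tendsto_ratio [SFinite ν] (hinv : ∀ h, ν.map (shift h) = ν)
    (hν : ν {f | 1 < f.1 0} = 1)
    (hfin : ν {f | 0 < sojournIn 0 (box d 0 1) f} < ∞) (hδ : 0 ≤ δ)
    (h : 0 < ν {f | 1 < f.1 0 ∧ x < sojournIn δ Set.univ f ∧ sojournIn δ Set.univ f < ∞}) :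
    ∃ l, Tendsto (ratio ν δ x) atTop (𝓝 l) ∧ 0 < l ∧ l < ∞ := by
  have hlow := limitValue_le_liminf (x := x) hinv hδ
  have hpos := limitValue_pos h
  by_cases hx : 0 < x ∨ 0 < δ
  · obtain ⟨C, hC, hb⟩ := exists_truncInv_bound (d := d) hx
    exact ⟨_, tendsto_of_le_liminf_of_limsup_le hlow (limsup_le_limitValue hinv hν hδ hC hb),
      hpos, limitValue_lt_top hν hx⟩
  · obtain ⟨hx0, hδ0⟩ := not_or.1 hx
    obtain rfl : x = 0 := by simpa using hx0
    obtain rfl : δ = 0 := le_antisymm (not_lt.1 hδ0) hδ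
    obtain ⟨l, hl, ht⟩ := tendsto_ratio_zero hinv hfin
    exact ⟨l, ht, hpos.trans_le (hlow.trans_eq ht.liminf_eq), hl⟩

end Limit

end Limits

/-! ### Transfer between the field `Z` and the spectral measure -/

section Main

variable {d : ℕ} {Ω : Type*} [MeasurableSpace Ω] {P : Measure Ω} {Z : (Fin d → ℝ) → Ω → ℝ}
  {X : Ω → Path d}

lemma IsSpectralField.lintegral_eq_one (hZ : IsSpectralField P Z) (t : Fin d → ℝ) :
    ∫⁻ ω, ENNReal.ofReal (Z t ω) ∂P = 1 := by
  have hint : Integrable (Z t) P := by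
    -- The integral of a non-integrable function is `0` by convention, so mean one forces
    -- integrability.
    by_contra h
    exact zero_ne_one ((integral_undef h).symm.trans (hZ.mean_one t))
  have h0 : 0 ≤ᵐ[P] Z t := by
    filter_upwards [hZ.paths] with ω hω using hω.1 t
  rw [← ofReal_integral_eq_lintegral_ofReal hint h0, hZ.mean_one t, ENNReal.ofReal_one]

lemma bermanRatio_eq_ratio [SFinite P] (hX : Measurable X)
    (hXZ : ∀ᵐ ω ∂P, (X ω).1 = fun t => Z t ω) (δ x T : ℝ) :
    bermanRatio P Z δ x T = ratio (spectralMeasure P X) δ (ENNReal.ofReal x) T := by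
  have hA : MeasurableSet {f : Path d | ENNReal.ofReal x < sojournIn δ (box d 0 T) f} :=
    measurableSet_lt measurable_const (measurable_sojournIn δ (measurableSet_box 0 T))
  rw [bermanRatio, ratio, bermanOn, spectralMeasure, Measure.map_apply (measurable_scale_inv hX) hA,
    Measure.prod_apply_symm (measurable_scale_inv hX hA)]
  congr 1
  refine setLIntegral_congr_fun measurableSet_Ioi fun s hs => measure_congr ?_
  filter_upwards [hXZ] with ω hω
  refine propext ?_
  change _ < sojourn δ (box d 0 T) (fun t => Z t ω) s ↔
    _ < sojournIn δ (box d 0 T) (scale s⁻¹ (X ω))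
  rw [sojourn_scale hs, hω]

/-- A positive sojourn of `Z` above `s` in the unit cube requires `s` below the supremum there, so
the mass is at most the expected supremum. -/
lemma spectralMeasure_sojournIn_lt_top (hZ : IsSpectralField P Z) (hX : Measurable X)
    (hXZ : ∀ᵐ ω ∂P, (X ω).1 = fun t => Z t ω) :
    spectralMeasure P X {f | 0 < sojournIn 0 (box d 0 1) f} < ∞ := by
  rw [spectralMeasure_apply hX
    (measurableSet_lt measurable_const (measurable_sojournIn 0 (measurableSet_box 0 1)))]
  refine lt_of_le_of_lt (lintegral_mono_ae ?_) (hZ.sup_integrable 1 one_pos)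
  filter_upwards [hXZ] with ω hω
  rw [← volume_Ioi_inter_ofReal_lt (⨆ t ∈ cube d 1, ENNReal.ofReal (Z t ω))]
  refine measure_mono fun s hs => ⟨hs.1, ?_⟩
  have hs0 : 0 < s := hs.1
  have h1 : 0 < sojournIn 0 (box d 0 1) (scale s⁻¹ (X ω)) := hs.2
  obtain ⟨t, ht, h2⟩ := nonempty_of_measure_ne_zero h1.ne'
  have h3 : s < Z t ω := by
    have := (lt_scale_inv_val hs0 (X ω) t).1 h2
    rwa [hω] at this
  refine lt_of_lt_of_le ?_ (le_iSup₂ (f := fun t _ => ENNReal.ofReal (Z t ω)) t ht)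
  exact (ENNReal.ofReal_lt_ofReal_iff_of_nonneg hs0.le).2 h3

lemma spectralMeasure_atom_eq_zero (hd : 1 ≤ d) (hX : Measurable X)
    (hc : ∀ᵐ ω ∂P, Continuous (X ω).1) {x : ℝ≥0∞} (hx : x ≠ ∞) :
    spectralMeasure P X {f | 1 < f.1 0 ∧ sojournIn 0 Set.univ f = x} = 0 := by
  have hm : MeasurableSet {f : Path d | 1 < f.1 0 ∧ sojournIn 0 Set.univ f = x} :=
    (measurableSet_lt measurable_const (measurable_eval 0)).inter
      (measurable_sojournIn 0 .univ (measurableSet_singleton x))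
  rw [spectralMeasure_apply hX hm, ← lintegral_zero (μ := P)]
  refine lintegral_congr_ae ?_
  filter_upwards [hc] with ω hω
  refine Set.Subsingleton.measure_zero ((subsingleton_level_of_volume hd hω hx).anti ?_) volume
  rintro s ⟨hs, h1, h2⟩
  refine ⟨(lt_scale_inv_val hs _ _).1 h1, ?_⟩
  rw [sojourn_scale hs, sojourn_eq, gridMeasure_zero, Set.univ_inter] at h2
  exact h2

/-- Markov's inequality for Lebesgue measure: the volume where the path exceeds `s` is at most its
total mass divided by `s`. -/
lemma ae_volume_exceed_lt_top [SFinite P] (hX : Measurable X)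
    (hS : ∀ᵐ ω ∂P, totalMass (X ω).1 < ∞) :
    ∀ᵐ f ∂(spectralMeasure P X), volume {t | 1 < f.1 t} < ∞ := by
  have hm : Measurable fun f : Path d => volume {t | 1 < f.1 t} :=
    measurable_measure_prodMk_left measurableSet_exceed_uncurry
  refine ae_spectralMeasure_of hX (measurableSet_lt hm measurable_const) ?_
  filter_upwards [hS] with ω hω s hs
  have h1 : {t | 1 < (scale s⁻¹ (X ω)).1 t} ⊆
      {t | ENNReal.ofReal s ≤ ENNReal.ofReal ((X ω).1 t)} := fun t ht =>
    ENNReal.ofReal_le_ofReal ((lt_scale_inv_val hs _ _).1 ht).le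
  have h2 : Measurable fun t => ENNReal.ofReal ((X ω).1 t) :=
    (measurable_eval_uncurry.comp (measurable_const.prodMk measurable_id)).ennreal_ofReal
  refine (measure_mono h1).trans_lt ?_
  refine (meas_ge_le_lintegral_div h2.aemeasurable (by simpa using hs)
    ENNReal.ofReal_ne_top).trans_lt ?_
  exact ENNReal.div_lt_top hω.ne (by simpa using hs)

lemma ae_sojournIn_univ_lt_top {ν : Measure (Path d)} (hinv : ∀ h, ν.map (shift h) = ν)
    (hν : ν {f | 1 < f.1 0} < ∞) (hfin : ∀ᵐ f ∂ν, volume {t | 1 < f.1 t} < ∞)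
    {δ : ℝ} (hδ : 0 ≤ δ) : ∀ᵐ f ∂ν, 1 < f.1 0 → sojournIn δ Set.univ f < ∞ := by
  rcases hδ.eq_or_lt with rfl | hδ
  · filter_upwards [hfin] with f hf _
    rwa [sojournIn, gridMeasure_zero, Set.univ_inter]
  · filter_upwards [ae_tsum_lattice_lt_top hinv hν hfin hδ] with f hf h
    rw [sojournIn, gridMeasure_apply hδ.ne', Set.univ_inter]
    exact ENNReal.mul_lt_top ENNReal.ofReal_lt_top (hf h)

lemma map_shift_spectralMeasure_of_isStationary [SFinite P] (hZ : IsSpectralField P Z)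
    (hX : Measurable X) (hXZ : ∀ᵐ ω ∂P, (X ω).1 = fun t => Z t ω)
    {Ω₁ : Type*} [MeasurableSpace Ω₁] {P₁ : Measure Ω₁} [IsProbabilityMeasure P₁]
    {V : ℕ → Ω₁ → ℝ} {Zs : ℕ → (Fin d → ℝ) → Ω₁ → ℝ} (hV : IsDeHaanFamily P Z P₁ V Zs)
    (hstat : IsStationary P₁ (maxStableField V Zs)) (h : Fin d → ℝ) :
    (spectralMeasure P X).map (shift h) = spectralMeasure P X := by
  have hmax : ∀ F h, ∫⁻ ω, maxRatio F h (X ω).1 ∂P = ∫⁻ ω, maxRatio F h (fun t => Z t ω) ∂P :=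
    fun F h => lintegral_congr_ae <| by
      filter_upwards [hXZ] with ω hω
      rw [hω]
  refine map_shift_spectralMeasure hX (fun F h hF => ?_) (fun t => ?_) ?_ h
  · rw [hmax, hmax]
    exact lintegral_maxRatio_eq hZ.measurable hV hstat hF h 0
  · refine lt_of_eq_of_lt ?_ ENNReal.one_lt_top
    rw [← hZ.lintegral_eq_one t]
    refine lintegral_congr_ae ?_
    filter_upwards [hXZ] with ω hω
    rw [hω]
  · filter_upwards [hXZ, hZ.sup_pos] with ω hω hpos
    rwa [hω]

end Main

end Berman

end

/-! ### The theorem -/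

theorem mainTheorem10 {d : ℕ} (hd : 1 ≤ d)
    {Ω Ω₁ Ω₂ : Type*} [MeasurableSpace Ω] [MeasurableSpace Ω₁] [MeasurableSpace Ω₂]
    -- the spectral random field `Z`
    (P : Measure Ω) [IsProbabilityMeasure P] (Z : (Fin d → ℝ) → Ω → ℝ)
    (hZ : Berman.IsSpectralField P Z)
    -- the stationary max-stable random field `X` with de Haan representation given by `Z`
    (P₁ : Measure Ω₁) [IsProbabilityMeasure P₁]
    (V : ℕ → Ω₁ → ℝ) (Zs : ℕ → (Fin d → ℝ) → Ω₁ → ℝ)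
    (hVZ : Berman.IsDeHaanFamily P Z P₁ V Zs)
    (hX : Berman.IsStationary P₁ (Berman.maxStableField V Zs))
    -- the random field `Y = R Θ`
    (P₂ : Measure Ω₂) [IsProbabilityMeasure P₂]
    (Θ : (Fin d → ℝ) → Ω₂ → ℝ) (hΘ : Berman.IsTilted P Z P₂ Θ)
    (R : Ω₂ → ℝ) (hRm : Measurable R) (hR : P₂.map R = paretoMeasure 1 1)
    (hRΘ : IndepFun R (fun ω t => Θ t ω) P₂)
    (Y : (Fin d → ℝ) → Ω₂ → ℝ) (hY : ∀ t ω, Y t ω = R ω * Θ t ω)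
    (hS : P {ω | Berman.totalMass (fun t => Z t ω) = ∞} < 1) :
    -- the law of `ε_0(Y)` has no atoms in `[0, ∞)` if `Z` has continuous paths
    ((∀ᵐ ω ∂P, Continuous fun t => Z t ω) →
      ∀ x : ℝ≥0∞, x ≠ ∞ → P₂ {ω | Berman.epsilon 0 (fun t => Y t ω) = x} = 0) ∧
    -- the Berman function is well defined and positive
    (∀ δ x : ℝ, 0 ≤ δ → 0 ≤ x →
      0 < P₂ {ω | ENNReal.ofReal x < Berman.epsilon δ (fun t => Y t ω) ∧
        Berman.epsilon δ (fun t => Y t ω) < ∞} →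
      Tendsto (Berman.bermanRatio P Z δ x) atTop (𝓝 (Berman.bermanFunction P Z δ x)) ∧
        0 < Berman.bermanFunction P Z δ x ∧ Berman.bermanFunction P Z δ x < ∞) ∧
    -- if `S_0 < ∞` almost surely, then `ε_δ(Y)` is almost surely finite
    ((∀ᵐ ω ∂P, Berman.totalMass (fun t => Z t ω) < ∞) →
      ∀ δ : ℝ, 0 ≤ δ → ∀ᵐ ω ∂P₂, Berman.epsilon δ (fun t => Y t ω) < ∞) := by
  obtain ⟨X, hXm, hXZ⟩ := Berman.exists_path_modification hZ.measurable hZ.paths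
  have hRpos : ∀ᵐ ω ∂P₂, 1 ≤ R ω := by
    have h := Berman.ae_paretoMeasure_one_le
    rw [← hR] at h
    exact ae_of_ae_map hRm.aemeasurable h
  obtain ⟨W, hWm, hWY⟩ := Berman.exists_path_modification (P := P₂) (X := Y)
    (fun t => by
      rw [show Y t = fun ω => R ω * Θ t ω from funext (hY t)]
      exact hRm.mul (hΘ.measurable t))
    (by
      filter_upwards [hΘ.paths, hRpos] with ω hω hr
      simp only [hY]
      exact Berman.mul_mem_cadlagSpace hω (zero_le_one.trans hr))
  have hlaw := Berman.map_eq_restrict_spectralMeasure hZ.measurable hXm hXZ hΘ hRm hR hRΘ hWm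
    (by simpa only [hY] using hWY)
  have hinv := Berman.map_shift_spectralMeasure_of_isStationary hZ hXm hXZ hVZ hX
  set ν := Berman.spectralMeasure P X with hν
  -- The restriction of `ν` to this set is the law of `Y`, a probability measure.
  have hν1 : ν {f | 1 < f.1 0} = 1 := by
    have : IsProbabilityMeasure (P₂.map W) := Measure.isProbabilityMeasure_map hWm.aemeasurable
    rw [← Measure.restrict_apply_univ, ← hlaw, measure_univ]
  -- All three claims concern the law of `ε_δ(Y)`; they use `S = {x}`, `S = (x, ∞)` and `S = {∞}`.
  have hev : ∀ δ : ℝ, ∀ S : Set ℝ≥0∞, MeasurableSet S →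
      P₂ {ω | Berman.epsilon δ (fun t => Y t ω) ∈ S} =
        ν {f | 1 < f.1 0 ∧ Berman.sojournIn δ Set.univ f ∈ S} := by
    intro δ S hS
    have hmS := Berman.measurable_sojournIn (d := d) δ .univ hS
    have h1 : P₂ {ω | Berman.epsilon δ (fun t => Y t ω) ∈ S} =
        P₂.map W (Berman.sojournIn δ Set.univ ⁻¹' S) := by
      rw [Measure.map_apply hWm hmS]
      refine measure_congr ?_
      filter_upwards [hWY] with ω hω
      change (Berman.epsilon δ (fun t => Y t ω) ∈ S) = (Berman.sojournIn δ Set.univ (W ω) ∈ S)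
      rw [← Berman.epsilon_eq, hω]
    rw [h1, hlaw, Measure.restrict_apply hmS, Set.inter_comm]
    rfl
  refine ⟨fun hc x hx => ?_, fun δ x hδ _ hpos => ?_, fun hS δ hδ => ?_⟩
  · refine (hev 0 {x} (measurableSet_singleton x)).trans ?_
    refine Berman.spectralMeasure_atom_eq_zero hd hXm ?_ hx
    filter_upwards [hc, hXZ] with ω h1 h2
    rwa [h2]
  · have hpos' := hpos.trans_eq (hev δ (Set.Ioo (ENNReal.ofReal x) ∞) measurableSet_Ioo)
    obtain ⟨l, hl, hl0, hlt⟩ := Berman.exists_tendsto_ratio hinv hν1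
      (Berman.spectralMeasure_sojournIn_lt_top hZ hXm hXZ) hδ hpos'
    have hratio : Berman.bermanRatio P Z δ x = Berman.ratio ν δ (ENNReal.ofReal x) :=
      funext fun T => Berman.bermanRatio_eq_ratio hXm hXZ δ x T
    rw [← hratio] at hl
    have hB : Berman.bermanFunction P Z δ x = l := hl.limUnder_eq
    rw [hB]
    exact ⟨hl, hl0, hlt⟩
  · have hfin := Berman.ae_volume_exceed_lt_top hXm (P := P) (by
      filter_upwards [hS, hXZ] with ω h1 h2
      rwa [h2])
    have hae := Berman.ae_sojournIn_univ_lt_top hinv (hν1.trans_lt ENNReal.one_lt_top) hfin hδ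
    rw [ae_iff]
    refine Eq.trans ?_ ((hev δ {∞} (measurableSet_singleton _)).trans ?_)
    · simp
    · refine measure_mono_null ?_ hae
      rintro f ⟨h1, h2⟩ h3
      exact (h3 h1).ne h2
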